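/- **Theorem 7.1 (Robertson–Walker in quadratic gravity).** Let $(M,g)$ be a smooth Lorentzian manifold of dimension $n\ge 3$ and signature $(-,+,\dots,+)$, and let $u$ be a vector field on $M$ such that $(M,g,u)$ is a generalized Robertson–Walker (GRW) space-time: around every point there are coordinates $(t,x^1,\dots,x^{n-1})$ in which $u=\partial_t$ and $$ds^2=-dt^2+q(t)^2\,g^*_{\mu\nu}(x)\,dx^\mu dx^\nu ,$$ with $q>0$ smooth on an open interval and $g^*$ a smooth Riemannian metric. Suppose that $(M,g)$ is Robertson–Walker, i.e. conformally flat: its Weyl tensor vanishes and, if $n=3$ (where the Weyl tensor is always zero), its Cotton tensor $$\nabla_kR_{jl}-\nabla_jR_{kl}+\tfrac{1}{2(n-1)}\left(g_{kl}\nabla_jR-g_{jl}\nabla_kR\right)$$ vanishes. Say that a symmetric tensor $S_{kl}$ is a perfect fluid if $S_{kl}=a\,g_{kl}+b\,u_ku_l$ for some smooth scalar fields $a,b$ on $M$. Let the curvature signs be $[\nabla_j,\nabla_k]w_l=R_{jkl}{}^mw_m$, $R_{kl}=g^{ab}R_{akbl}$, $R=g^{kl}R_{kl}$, and $\nabla^2=g^{ab}\nabla_a\nabla_b$.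 Then: 1. For all real $\kappa\ne0,\Lambda_0,\alpha,\beta,\gamma$, the stress-energy tensor of the quadratic theory of gravity with gravitational action $$\int d^nx\sqrt{-g}\,\Big[\tfrac{R-2\Lambda_0}{\kappa}+\alpha R^2+\beta R_{ij}R^{ij}+\gamma\,\mathcal G\Big],\qquad \mathcal G=R_{jklm}R^{jklm}-4R_{jk}R^{jk}+R^2,$$ given by the field equations $$\begin{aligned}T_{kl}={}&\tfrac1\kappa\big(R_{kl}-\tfrac12Rg_{kl}+\Lambda_0g_{kl}\big)+2\alpha R\big(R_{kl}-\tfrac14Rg_{kl}\big)+(2\alpha+\beta)\big(g_{kl}\nabla^2-\nabla_k\nabla_l\big)R\\&+2\gamma\big[RR_{kl}-2R_{akbl}R^{ab}+R_{kcde}R_l{}^{cde}-2R_{ka}R_l{}^a-\tfrac14g_{kl}\,\mathcal G\big]\\&+\beta\nabla^2\big(R_{kl}-\tfrac12Rg_{kl}\big)+2\beta\big(R_{akbl}-\tfrac14g_{kl}R_{ab}\big)R^{ab},\end{aligned}$$ is a perfect fluid. 2. Each of the tensors $R_{kl}$, $\nabla_k\nabla_lR$, $\nabla^2R_{kl}$,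 $R_{ka}R_l{}^a$, $R_{akbl}R^{ab}$ and $R_{kcde}R_l{}^{cde}$ is a perfect fluid. -/

import Mathlib

open scoped Manifold ContDiff

noncomputable section

namespace QuadraticGravity

/-! ## Tensor calculus in one coordinate system

All tensors have lower indices, and are given by their components as functions of the coordinates
`x`. The metric components form the matrix-valued function `G`. -/

/-- The coordinate space of an `n`-dimensional manifold. -/
abbrev Coord (n : ℕ) : Type := EuclideanSpace ℝ (Fin n)

/-- Components of a metric in a coordinate system. -/
abbrev MetricComp (n : ℕ) : Type := Coord n → Matrix (Fin n) (Fin n) ℝ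

section Coordinates

variable {n : ℕ}

/-- The partial derivative `∂ᵢ f`. -/
def pd (i : Fin n) (f : Coord n → ℝ) (x : Coord n) : ℝ :=
  fderiv ℝ f x (EuclideanSpace.single i 1)

/-- The inverse metric `gⁱʲ`. -/
def gInv (G : MetricComp n) (x : Coord n) (i j : Fin n) : ℝ := (G x)⁻¹ i j

/-- The Christoffel symbols `Γᵐᵢⱼ` of the Levi-Civita connection. -/
def christoffel (G : MetricComp n) (x : Coord n) (m i j : Fin n) : ℝ :=
  (1 / 2) * ∑ s, gInv G x m s *
    (pd i (fun y => G y s j) x + pd j (fun y => G y i s) x - pd s (fun y => G y i j) x)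

/-- `∇ₐ w_k` for a covector field. -/
def cov1 (G : MetricComp n) (w : Coord n → Fin n → ℝ) (x : Coord n) (a k : Fin n) : ℝ :=
  pd a (fun y => w y k) x - ∑ m, christoffel G x m a k * w x m

/-- `∇ₐ S_{kl}` for a tensor field of rank two. -/
def cov2 (G : MetricComp n) (S : Coord n → Fin n → Fin n → ℝ) (x : Coord n)
    (a k l : Fin n) : ℝ :=
  pd a (fun y => S y k l) x
    - ∑ m, christoffel G x m a k * S x m l - ∑ m, christoffel G x m a l * S x k m

/-- `∇ₐ S_{bkl}` for a tensor field of rank three. -/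
def cov3 (G : MetricComp n) (S : Coord n → Fin n → Fin n → Fin n → ℝ) (x : Coord n)
    (a b k l : Fin n) : ℝ :=
  pd a (fun y => S y b k l) x
    - ∑ m, christoffel G x m a b * S x m k l
    - ∑ m, christoffel G x m a k * S x b m l
    - ∑ m, christoffel G x m a l * S x b k m

/-- The Hessian `∇_k ∇_l f` of a scalar. -/
def hess (G : MetricComp n) (f : Coord n → ℝ) (x : Coord n) (k l : Fin n) : ℝ :=
  cov1 G (fun y j => pd j f y) x k l

/-- The wave operator `∇² f = gᵃᵇ ∇ₐ ∇_b f` on scalars. -/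
def box0 (G : MetricComp n) (f : Coord n → ℝ) (x : Coord n) : ℝ :=
  ∑ a, ∑ b, gInv G x a b * hess G f x a b

/-- The wave operator `∇² S_{kl} = gᵃᵇ ∇ₐ ∇_b S_{kl}` on tensors of rank two. -/
def box2 (G : MetricComp n) (S : Coord n → Fin n → Fin n → ℝ) (x : Coord n)
    (k l : Fin n) : ℝ :=
  ∑ a, ∑ b, gInv G x a b * cov3 G (cov2 G S) x a b k l

/-- The curvature `R_{abc}{}^d`, with the sign `[∇ₐ, ∇_b] w_c = R_{abc}{}^d w_d`. -/
def riemUp (G : MetricComp n) (x : Coord n) (a b c d : Fin n) : ℝ :=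
  pd b (fun y => christoffel G y d a c) x - pd a (fun y => christoffel G y d b c) x
    + ∑ e, (christoffel G x e a c * christoffel G x d e b
      - christoffel G x e b c * christoffel G x d e a)

/-- The Riemann tensor `R_{abcd}`. -/
def riem (G : MetricComp n) (x : Coord n) (a b c d : Fin n) : ℝ :=
  ∑ m, riemUp G x a b c m * G x m d

/-- The Ricci tensor `R_{kl} = gᵃᵇ R_{akbl}`. -/
def ric (G : MetricComp n) (x : Coord n) (k l : Fin n) : ℝ :=
  ∑ a, ∑ b, gInv G x a b * riem G x a k b l

/-- The scalar curvature `R = gᵏˡ R_{kl}`. -/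
def scal (G : MetricComp n) (x : Coord n) : ℝ :=
  ∑ k, ∑ l, gInv G x k l * ric G x k l

/-- The Ricci tensor with raised indices, `Rᵃᵇ`. -/
def ricUp (G : MetricComp n) (x : Coord n) (a b : Fin n) : ℝ :=
  ∑ c, ∑ d, gInv G x a c * gInv G x b d * ric G x c d

/-- `R_{ka} R_l{}^a`. -/
def ricRic (G : MetricComp n) (x : Coord n) (k l : Fin n) : ℝ :=
  ∑ a, ∑ b, gInv G x a b * (ric G x k a * ric G x l b)

/-- `R_{ab} Rᵃᵇ`. -/
def ricSq (G : MetricComp n) (x : Coord n) : ℝ :=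
  ∑ a, ∑ b, ric G x a b * ricUp G x a b

/-- `R_{akbl} Rᵃᵇ`. -/
def riemRic (G : MetricComp n) (x : Coord n) (k l : Fin n) : ℝ :=
  ∑ a, ∑ b, riem G x a k b l * ricUp G x a b

/-- `R_{kcde} R_l{}^{cde}`. -/
def riemRiem (G : MetricComp n) (x : Coord n) (k l : Fin n) : ℝ :=
  ∑ c, ∑ d, ∑ e, ∑ c', ∑ d', ∑ e',
    gInv G x c c' * gInv G x d d' * gInv G x e e' * (riem G x k c d e * riem G x l c' d' e')

/-- `R_{jklm} Rʲᵏˡᵐ`. -/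
def riemSq (G : MetricComp n) (x : Coord n) : ℝ :=
  ∑ k, ∑ l, gInv G x k l * riemRiem G x k l

/-- The Weyl tensor `C_{abcd}` (for `n ≥ 3`). -/
def weyl (G : MetricComp n) (x : Coord n) (a b c d : Fin n) : ℝ :=
  riem G x a b c d
    - 1 / ((n : ℝ) - 2) * (G x a c * ric G x b d - G x a d * ric G x b c
        - G x b c * ric G x a d + G x b d * ric G x a c)
    + scal G x / (((n : ℝ) - 1) * ((n : ℝ) - 2)) * (G x a c * G x b d - G x a d * G x b c)

/-- The Cotton tensor
`∇_k R_{jl} - ∇_j R_{kl} + (g_{kl} ∇_j R - g_{jl} ∇_k R) / (2 (n - 1))`. -/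
def cotton (G : MetricComp n) (x : Coord n) (j k l : Fin n) : ℝ :=
  cov2 G (ric G) x k j l - cov2 G (ric G) x j k l
    + (pd j (scal G) x * G x k l - pd k (scal G) x * G x j l) / (2 * ((n : ℝ) - 1))

/-- The Gauss-Bonnet scalar `R_{jklm} Rʲᵏˡᵐ - 4 R_{jk} Rʲᵏ + R²`. -/
def gaussBonnet (G : MetricComp n) (x : Coord n) : ℝ :=
  riemSq G x - 4 * ricSq G x + scal G x ^ 2

/-- The stress-energy tensor `T_{kl}` of quadratic gravity, that is, the left side of the field
equations obtained by varying with respect to the metric the gravitational action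
`∫ √(-g) [(R - 2 Λ₀)/κ + α R² + β R_{ij} Rⁱʲ + γ (R_{jklm} Rʲᵏˡᵐ - 4 R_{jk} Rʲᵏ + R²)]`. -/
def stressEnergy (κ Λ₀ α β γ : ℝ) (G : MetricComp n) (x : Coord n) (k l : Fin n) : ℝ :=
  1 / κ * (ric G x k l - 1 / 2 * scal G x * G x k l + Λ₀ * G x k l)
    + 2 * α * scal G x * (ric G x k l - 1 / 4 * scal G x * G x k l)
    + (2 * α + β) * (G x k l * box0 G (scal G) x - hess G (scal G) x k l)
    + 2 * γ * (scal G x * ric G x k l - 2 * riemRic G x k l + riemRiem G x k l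
        - 2 * ricRic G x k l - 1 / 4 * G x k l * gaussBonnet G x)
    + β * box2 G (fun y i j => ric G y i j - 1 / 2 * scal G y * G y i j) x k l
    + 2 * β * (riemRic G x k l - 1 / 4 * G x k l * ricSq G x)

end Coordinates

/-! ## Lorentzian manifolds -/

section Manifold

variable {n : ℕ} {M : Type*} [TopologicalSpace M] [ChartedSpace (Coord n) M]

/-- The coordinate vector field `∂ᵢ` of the chart `e`, at the point with coordinates `x`. -/
def coordVec (e : OpenPartialHomeomorph M (Coord n)) (x : Coord n) (i : Fin n) :
    TangentSpace (𝓡 n) (e.symm x) :=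
  mfderiv (𝓡 n) (𝓡 n) e.symm x (EuclideanSpace.single i 1 : Coord n)

/-- The components `g(∂ᵢ, ∂ⱼ)` of a field of bilinear forms in the chart `e`. -/
def compOf (g : ∀ p : M, TangentSpace (𝓡 n) p →L[ℝ] TangentSpace (𝓡 n) p →L[ℝ] ℝ)
    (e : OpenPartialHomeomorph M (Coord n)) : MetricComp n :=
  fun x => Matrix.of fun i j => g (e.symm x) (coordVec e x i) (coordVec e x j)

variable (n M) in
/-- A smooth Lorentzian metric, of signature `(-, +, …, +)`. Smoothness means that the components
are smooth in every chart. -/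
structure LorentzMetric where
  form : ∀ p : M, TangentSpace (𝓡 n) p →L[ℝ] TangentSpace (𝓡 n) p →L[ℝ] ℝ
  symm : ∀ (p : M) (v w : TangentSpace (𝓡 n) p), form p v w = form p w v
  lorentz : ∀ p : M, ∃ v : TangentSpace (𝓡 n) p, form p v v < 0 ∧
    ∀ w : TangentSpace (𝓡 n) p, form p v w = 0 → w ≠ 0 → 0 < form p w w
  smooth : ∀ e ∈ IsManifold.maximalAtlas (𝓡 n) ∞ M, ∀ i j : Fin n,
    ContDiffOn ℝ ∞ (fun x => compOf form e x i j) e.target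

/-- The components `g_{ij}` of the metric in the chart `e`. -/
def LorentzMetric.comp (g : LorentzMetric n M) (e : OpenPartialHomeomorph M (Coord n)) :
    MetricComp n :=
  compOf g.form e

/-- The components `u_k` of the covector field dual to the vector field `u`, in the chart `e`. -/
def LorentzMetric.lower (g : LorentzMetric n M) (u : ∀ p : M, TangentSpace (𝓡 n) p)
    (e : OpenPartialHomeomorph M (Coord n)) (x : Coord n) (k : Fin n) : ℝ :=
  g.form (e.symm x) (u (e.symm x)) (coordVec e x k)

/-- A tensor `S` of rank two (given by its components as an expression in the metric components)
has the perfect fluid form `S_{kl} = a g_{kl} + b u_k u_l`, for smooth scalar fields `a`, `b` on the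
manifold. -/
def IsPerfectFluid (g : LorentzMetric n M) (u : ∀ p : M, TangentSpace (𝓡 n) p)
    (S : MetricComp n → Coord n → Fin n → Fin n → ℝ) : Prop :=
  ∃ a b : M → ℝ, ContMDiff (𝓡 n) 𝓘(ℝ, ℝ) ∞ a ∧ ContMDiff (𝓡 n) 𝓘(ℝ, ℝ) ∞ b ∧
    ∀ e ∈ IsManifold.maximalAtlas (𝓡 n) ∞ M, ∀ x ∈ e.target, ∀ k l : Fin n,
      S (g.comp e) x k l =
        a (e.symm x) * g.comp e x k l + b (e.symm x) * (g.lower u e x k * g.lower u e x l)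

end Manifold

/-! ## Generalized Robertson-Walker space-times, of dimension `n = d + 1` -/

section GRW

variable {d : ℕ} {M : Type*} [TopologicalSpace M] [ChartedSpace (Coord (d + 1)) M]

/-- The spatial coordinates of a point with coordinates `(t, x¹, …, xᵈ)`. -/
def spatial (x : Coord (d + 1)) : Coord d := WithLp.toLp 2 fun μ => x μ.succ

/-- The chart `e`, with image `J × V`, is a comoving chart: in it the metric is
`-dt² + q(t)² g*_{μν}(x) dx^μ dx^ν`, where `q` is a positive smooth function on the open interval
`J` and `g*` is a Riemannian metric on `V`, and the vector field `u` is `∂_t`. -/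
def IsComovingChart (g : LorentzMetric (d + 1) M) (u : ∀ p : M, TangentSpace (𝓡 (d + 1)) p)
    (e : OpenPartialHomeomorph M (Coord (d + 1))) : Prop :=
  e ∈ IsManifold.maximalAtlas (𝓡 (d + 1)) ∞ M ∧
  ∃ (J : Set ℝ) (V : Set (Coord d)) (q : ℝ → ℝ) (h : Coord d → Matrix (Fin d) (Fin d) ℝ),
    IsOpen J ∧ J.OrdConnected ∧ IsOpen V ∧
    e.target = {x | x 0 ∈ J ∧ spatial x ∈ V} ∧
    ContDiffOn ℝ ∞ q J ∧ (∀ t ∈ J, 0 < q t) ∧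
    (∀ μ ν, ContDiffOn ℝ ∞ (fun y => h y μ ν) V) ∧ (∀ y ∈ V, (h y).PosDef) ∧
    ∀ x ∈ e.target,
      u (e.symm x) = coordVec e x 0 ∧
      g.comp e x 0 0 = -1 ∧
      (∀ μ : Fin d, g.comp e x 0 μ.succ = 0) ∧
      ∀ μ ν : Fin d, g.comp e x μ.succ ν.succ = q (x 0) ^ 2 * h (spatial x) μ ν

/-- A generalized Robertson-Walker (GRW) space-time with velocity field `u`: every point lies in a
comoving chart. In particular, this includes every warped product `J ×_q M*` of an open interval
`J` and a Riemannian manifold `M*`, with `u = ∂_t`. -/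
def IsGRW (g : LorentzMetric (d + 1) M) (u : ∀ p : M, TangentSpace (𝓡 (d + 1)) p) : Prop :=
  ∀ p : M, ∃ e, IsComovingChart g u e ∧ p ∈ e.source

/-- A Robertson-Walker space-time of dimension `d + 1 ≥ 3`: a conformally flat GRW space-time, that
is, one whose Weyl tensor vanishes. In dimension three the Weyl tensor of every metric vanishes, and
conformal flatness is the vanishing of the Cotton tensor. -/
def IsRobertsonWalker (g : LorentzMetric (d + 1) M)
    (u : ∀ p : M, TangentSpace (𝓡 (d + 1)) p) : Prop :=
  IsGRW g u ∧
  (∀ e ∈ IsManifold.maximalAtlas (𝓡 (d + 1)) ∞ M, ∀ x ∈ e.target, ∀ i j k l,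
    weyl (g.comp e) x i j k l = 0) ∧
  (d + 1 = 3 → ∀ e ∈ IsManifold.maximalAtlas (𝓡 (d + 1)) ∞ M, ∀ x ∈ e.target, ∀ j k l,
    cotton (g.comp e) x j k l = 0)

end GRW

end QuadraticGravity

end

open QuadraticGravity

/-! In a GRW space-time `u` is a unit vector with `∇ₐ u_k = φ (g_{ak} + uₐ u_k)`, where `φ = q'/q`,
and the gradient of any function of time is a multiple of `u`. Consequently the tensors `a g + b u ⊗
u` with `a`, `b` functions of time are stable under every operation that builds the field equations.
Contracted products stay in the class because `uₐ uᵃ = -1`; Hessians of functions of time and the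
wave operator stay in it by the torse-forming equation (`IsTorseForming.hess_eq`,
`IsTorseForming.box2_perfectFluid`). It therefore suffices to express the curvature through `g`, `u`
and functions of time.

The Ricci identity applied to `u` gives the Riemann tensor with one slot contracted with `u`
(`IsTorseForming.sum_riemUp_mul`). Inserted into the Weyl component `C_{a0c0} = 0`, it determines
the Ricci tensor as a perfect fluid whose coefficients involve the scalar curvature `R`, `φ` and the
time derivative of `φ` (`IsComovingMetric.ric_eq`). Vanishing of the whole Weyl tensor then gives
the whole Riemann tensor (`riem_of_weyl_eq_zero`), and its quadratic contractions are algebra.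

The point that is not formal is that `R` depends on time only. For `n ≥ 4` this is Schur's argument:
on a pair of spatial directions the curvature is `P (g g - g g)`, and the second Bianchi identity on
three distinct spatial directions forces the spatial derivatives of `P` to vanish
(`IsComovingMetric.pd_scal_of_three_le`). For `n = 3` there are only two spatial directions, and a
component of the Cotton tensor takes over (`IsComovingMetric.pd_scal_of_cotton`).

The coefficients must also be global scalars, with the identities valid in every chart. Each scalar
is defined at a point through a chosen comoving chart, and a tensorial equation shows that the
choice does not matter: `φ` is read off from `∇u`, the derivative of a time scalar from its
gradient, and `R` from the trace of the Ricci formula. The resulting scalars form the algebra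
`timeScalars`, closed under the derivative along `u` (`IsGRW.exists_grad`). Transformation laws are
thus needed only for low-order objects; the second-order calculations are done directly in an
arbitrary chart. -/

noncomputable section

namespace QuadraticGravity

/-! ### Partial derivatives of smooth functions. -/

section Calculus

variable {n : ℕ} {Ω : Set (Coord n)} {x : Coord n} {f g : Coord n → ℝ}

theorem pd_congr (hΩ : IsOpen Ω) (hx : x ∈ Ω) (h : ∀ y ∈ Ω, f y = g y) (i : Fin n) :
    pd i f x = pd i g x := by
  have : f =ᶠ[nhds x] g := Filter.eventuallyEq_of_mem (hΩ.mem_nhds hx) h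
  simp [pd, this.fderiv_eq]

theorem _root_.ContDiffOn.differentiableAt_of_isOpen (hf : ContDiffOn ℝ ∞ f Ω) (hΩ : IsOpen Ω)
    (hx : x ∈ Ω) : DifferentiableAt ℝ f x :=
  (hf.contDiffAt (hΩ.mem_nhds hx)).differentiableAt (by simp)

theorem contDiffOn_pd (hΩ : IsOpen Ω) (hf : ContDiffOn ℝ ∞ f Ω) (i : Fin n) :
    ContDiffOn ℝ ∞ (pd i f) Ω :=
  (hf.fderiv_of_isOpen hΩ (m := ∞) (by simp)).clm_apply contDiffOn_const

theorem pd_const (i : Fin n) (c : ℝ) : pd i (fun _ => c) x = 0 := by simp [pd]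

theorem pd_add (hf : DifferentiableAt ℝ f x) (hg : DifferentiableAt ℝ g x) (i : Fin n) :
    pd i (fun y => f y + g y) x = pd i f x + pd i g x := by
  simp [pd, fderiv_fun_add hf hg]

theorem pd_sub (hf : DifferentiableAt ℝ f x) (hg : DifferentiableAt ℝ g x) (i : Fin n) :
    pd i (fun y => f y - g y) x = pd i f x - pd i g x := by
  simp [pd, fderiv_fun_sub hf hg]

theorem pd_neg (i : Fin n) : pd i (fun y => -f y) x = -pd i f x := by
  simp [pd]

theorem pd_mul (hf : DifferentiableAt ℝ f x) (hg : DifferentiableAt ℝ g x) (i : Fin n) :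
    pd i (fun y => f y * g y) x = pd i f x * g x + f x * pd i g x := by
  simp [pd, fderiv_fun_mul hf hg]; ring

theorem pd_const_mul (hf : DifferentiableAt ℝ f x) (c : ℝ) (i : Fin n) :
    pd i (fun y => c * f y) x = c * pd i f x := by
  rw [pd_mul (by fun_prop) hf, pd_const]; ring

theorem pd_sum {ι : Type*} {s : Finset ι} {F : ι → Coord n → ℝ}
    (h : ∀ j ∈ s, DifferentiableAt ℝ (F j) x) (i : Fin n) :
    pd i (fun y => ∑ j ∈ s, F j y) x = ∑ j ∈ s, pd i (F j) x := by
  simp [pd, fderiv_fun_sum h]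

theorem pd_comm (hΩ : IsOpen Ω) (hx : x ∈ Ω) (hf : ContDiffOn ℝ ∞ f Ω) (i j : Fin n) :
    pd i (pd j f) x = pd j (pd i f) x := by
  have hc : ContDiffAt ℝ ∞ f x := hf.contDiffAt (hΩ.mem_nhds hx)
  have hs : IsSymmSndFDerivAt ℝ f x := hc.isSymmSndFDerivAt (by
    rw [minSmoothness_of_isRCLikeNormedField]; exact WithTop.coe_le_coe.2 le_top)
  have hd : DifferentiableAt ℝ (fderiv ℝ f) x :=
    (hc.fderiv_right (m := ∞) (by simp)).differentiableAt (by simp)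
  have key : ∀ a b : Fin n, pd a (pd b f) x
      = fderiv ℝ (fderiv ℝ f) x (EuclideanSpace.single a 1) (EuclideanSpace.single b 1) := by
    intro a b
    unfold pd
    rw [fderiv_clm_apply hd (by fun_prop)]
    simp
  rw [key, key, hs.eq]

theorem fderiv_eq_sum_pd (v : Coord n) : fderiv ℝ f x v = ∑ a, v a * pd a f x := by
  have hv : v = ∑ a, v a • (EuclideanSpace.single a 1 : Coord n) := by
    ext j
    simp [Finset.sum_apply, Pi.single_apply]
  conv_lhs => rw [hv]
  simp [pd]

theorem pd_comp {m : ℕ} {ψ : Coord n → Coord m} {F : Coord m → ℝ}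
    (hF : DifferentiableAt ℝ F (ψ x)) (hψ : DifferentiableAt ℝ ψ x) (i : Fin n) :
    pd i (fun y => F (ψ y)) x = ∑ a, pd i (fun y => ψ y a) x * pd a F (ψ x) := by
  have h1 : ∀ a, pd i (fun y => ψ y a) x = (fderiv ℝ ψ x (EuclideanSpace.single i 1)) a := by
    intro a
    have := ((EuclideanSpace.proj a : Coord m →L[ℝ] ℝ).hasFDerivAt.comp x hψ.hasFDerivAt).fderiv
    unfold pd
    change fderiv ℝ ((EuclideanSpace.proj a : Coord m →L[ℝ] ℝ) ∘ ψ) x _ = _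
    rw [this]; rfl
  simp_rw [h1]
  rw [← fderiv_eq_sum_pd]
  change fderiv ℝ (F ∘ ψ) x _ = _
  rw [fderiv_comp x hF hψ]; rfl

end Calculus

/-! ### The Levi-Civita connection and the Ricci identity. -/

/-- Components of a (semi-Riemannian) metric that is smooth and nondegenerate on an open set. -/
structure IsMetricOn {n : ℕ} (G : MetricComp n) (Ω : Set (Coord n)) : Prop where
  isOpen : IsOpen Ω
  smooth : ∀ i j, ContDiffOn ℝ ∞ (fun y => G y i j) Ω
  symm : ∀ x ∈ Ω, ∀ i j, G x i j = G x j i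
  isUnit_det : ∀ x ∈ Ω, IsUnit (G x).det

/-- The Christoffel symbols with all indices lowered, the last one being the upper index. -/
def christoffelLow {n : ℕ} (G : MetricComp n) (x : Coord n) (i j s : Fin n) : ℝ :=
  (1 / 2) * (pd i (fun y => G y s j) x + pd j (fun y => G y i s) x - pd s (fun y => G y i j) x)

namespace IsMetricOn

variable {n : ℕ} {G : MetricComp n} {Ω : Set (Coord n)} (hG : IsMetricOn G Ω) {x : Coord n}
include hG

theorem sum_gInv_mul (hx : x ∈ Ω) (i k : Fin n) :
    ∑ j, gInv G x i j * G x j k = if i = k then 1 else 0 := by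
  have := congrFun (congrFun (Matrix.nonsing_inv_mul _ (hG.isUnit_det x hx)) i) k
  simpa [Matrix.mul_apply, Matrix.one_apply, gInv] using this

theorem sum_mul_gInv (hx : x ∈ Ω) (i k : Fin n) :
    ∑ j, G x i j * gInv G x j k = if i = k then 1 else 0 := by
  have := congrFun (congrFun (Matrix.mul_nonsing_inv _ (hG.isUnit_det x hx)) i) k
  simpa [Matrix.mul_apply, Matrix.one_apply, gInv] using this

theorem gInv_symm (hx : x ∈ Ω) (i j : Fin n) : gInv G x i j = gInv G x j i := by
  have : (G x).transpose = G x := by ext a b; exact hG.symm x hx b a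
  have h2 := Matrix.transpose_nonsing_inv (G x)
  rw [this] at h2
  exact congrFun (congrFun h2 j) i

theorem smooth_gInv (i j : Fin n) : ContDiffOn ℝ ∞ (fun y => gInv G y i j) Ω := by
  have hdet : ∀ H : MetricComp n, (∀ i j, ContDiffOn ℝ ∞ (fun y => H y i j) Ω) →
      ContDiffOn ℝ ∞ (fun y => (H y).det) Ω := by
    intro H hH
    simp only [Matrix.det_apply]
    refine ContDiffOn.sum fun σ _ => ContDiffOn.const_smul _ ?_
    exact contDiffOn_prod fun i _ => hH _ _
  have : (fun y => gInv G y i j) = fun y => ((G y).det)⁻¹ * (G y).adjugate i j := by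
    ext y
    simp [gInv, Matrix.inv_def, Ring.inverse_eq_inv']
  rw [this]
  refine ContDiffOn.mul (ContDiffOn.inv (hdet G hG.smooth)
    fun y hy => (hG.isUnit_det y hy).ne_zero) ?_
  simp only [Matrix.adjugate_apply]
  -- An entry of the adjugate is the determinant of the matrix with one row replaced by a constant
  -- unit vector, so `hdet` applies again.
  refine hdet (fun y => (G y).updateRow j (Pi.single i 1)) fun a b => ?_
  by_cases h : a = j
  · subst h; simpa using contDiffOn_const
  · simpa [Matrix.updateRow_ne h] using hG.smooth a b

theorem smooth_christoffelLow (i j s : Fin n) :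
    ContDiffOn ℝ ∞ (fun y => christoffelLow G y i j s) Ω := by
  unfold christoffelLow
  exact contDiffOn_const.mul (((contDiffOn_pd hG.isOpen (hG.smooth _ _) _).add
    (contDiffOn_pd hG.isOpen (hG.smooth _ _) _)).sub (contDiffOn_pd hG.isOpen (hG.smooth _ _) _))

omit hG in
theorem _root_.QuadraticGravity.christoffel_eq (m i j : Fin n) :
    christoffel G x m i j = ∑ s, gInv G x m s * christoffelLow G x i j s := by
  simp only [christoffel, christoffelLow, Finset.mul_sum]
  exact Finset.sum_congr rfl fun s _ => by ring

theorem smooth_christoffel (m i j : Fin n) :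
    ContDiffOn ℝ ∞ (fun y => christoffel G y m i j) Ω := by
  simp only [christoffel_eq]
  exact ContDiffOn.sum fun s _ => (hG.smooth_gInv _ _).mul (hG.smooth_christoffelLow _ _ _)

theorem christoffelLow_symm (hx : x ∈ Ω) (i j s : Fin n) :
    christoffelLow G x i j s = christoffelLow G x j i s := by
  unfold christoffelLow
  rw [pd_congr hG.isOpen hx (fun y hy => hG.symm y hy s j) i,
    pd_congr hG.isOpen hx (fun y hy => hG.symm y hy i s) j,
    pd_congr hG.isOpen hx (fun y hy => hG.symm y hy i j) s]
  ring

theorem christoffel_symm (hx : x ∈ Ω) (m i j : Fin n) :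
    christoffel G x m i j = christoffel G x m j i := by
  simp only [christoffel_eq]
  exact Finset.sum_congr rfl fun s _ => by rw [hG.christoffelLow_symm hx]

theorem sum_christoffel_mul (hx : x ∈ Ω) (i j s : Fin n) :
    ∑ m, christoffel G x m i j * G x m s = christoffelLow G x i j s := by
  simp only [christoffel_eq, Finset.sum_mul]
  rw [Finset.sum_comm]
  have : ∀ t, ∑ m, gInv G x m t * christoffelLow G x i j t * G x m s
      = christoffelLow G x i j t * if t = s then 1 else 0 := by
    intro t
    rw [← hG.sum_gInv_mul hx t s, Finset.mul_sum]
    exact Finset.sum_congr rfl fun m _ => by rw [hG.gInv_symm hx m t]; ring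
  simp [this]

theorem pd_metric (hx : x ∈ Ω) (a k l : Fin n) :
    pd a (fun y => G y k l) x = christoffelLow G x a k l + christoffelLow G x a l k := by
  unfold christoffelLow
  rw [pd_congr hG.isOpen hx (fun y hy => hG.symm y hy l k) a,
    pd_congr hG.isOpen hx (fun y hy => hG.symm y hy a l) k,
    pd_congr hG.isOpen hx (fun y hy => hG.symm y hy a k) l]
  ring

theorem cov2_metric (hx : x ∈ Ω) (a k l : Fin n) : cov2 G (fun y => G y) x a k l = 0 := by
  unfold cov2
  have h := hG.sum_christoffel_mul hx a l k
  simp only [hG.symm x hx _ k] at h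
  rw [hG.pd_metric hx, hG.sum_christoffel_mul hx, h]
  ring

theorem smooth_cov1 {w : Coord n → Fin n → ℝ} (hw : ∀ k, ContDiffOn ℝ ∞ (fun y => w y k) Ω)
    (a k : Fin n) : ContDiffOn ℝ ∞ (fun y => cov1 G w y a k) Ω := by
  unfold cov1
  exact (contDiffOn_pd hG.isOpen (hw k) a).sub
    (ContDiffOn.sum fun m _ => (hG.smooth_christoffel _ _ _).mul (hw m))

/-- The Ricci identity for covectors. Second partials of `w` commute, the connection term on the
first derivative index cancels by torsion-freeness, and the terms with first derivatives of `w`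
cancel in pairs. It is used twice: on coordinate differentials it yields the transformation law of
the curvature, and on `u` it yields the curvature contracted with `u`. -/
theorem cov2_cov1_sub {w : Coord n → Fin n → ℝ} (hw : ∀ k, ContDiffOn ℝ ∞ (fun y => w y k) Ω)
    (hx : x ∈ Ω) (a b c : Fin n) :
    cov2 G (cov1 G w) x a b c - cov2 G (cov1 G w) x b a c = ∑ m, riemUp G x a b c m * w x m := by
  have hwd : ∀ k, DifferentiableAt ℝ (fun y => w y k) x :=
    fun k => (hw k).differentiableAt_of_isOpen hG.isOpen hx
  have hΓd : ∀ m i j, DifferentiableAt ℝ (fun y => christoffel G y m i j) x :=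
    fun m i j => (hG.smooth_christoffel m i j).differentiableAt_of_isOpen hG.isOpen hx
  have hpd : ∀ i k, DifferentiableAt ℝ (pd i (fun y => w y k)) x :=
    fun i k => (contDiffOn_pd hG.isOpen (hw k) i).differentiableAt_of_isOpen hG.isOpen hx
  have h1 : ∀ a b c, pd a (fun y => cov1 G w y b c) x = pd a (pd b (fun y => w y c)) x
      - ∑ m, (pd a (fun y => christoffel G y m b c) x * w x m
        + christoffel G x m b c * pd a (fun y => w y m) x) := by
    intro a b c
    unfold cov1
    rw [pd_sub (f := pd b (fun y => w y c)) (hpd _ _) (DifferentiableAt.fun_sum fun m _ => (hΓd _ _ _).fun_mul (hwd _)),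
      pd_sum (fun m _ => (hΓd _ _ _).fun_mul (hwd _))]
    congr 1
    exact Finset.sum_congr rfl fun m _ => pd_mul (hΓd _ _ _) (hwd _) _
  have h2 : ∀ a b c, ∑ m, christoffel G x m a c * cov1 G w x b m
      = ∑ m, christoffel G x m a c * pd b (fun y => w y m) x
        - ∑ m, ∑ e, christoffel G x e a c * christoffel G x m e b * w x m := by
    intro a b c
    rw [Finset.sum_comm, ← Finset.sum_sub_distrib]
    refine Finset.sum_congr rfl fun m _ => ?_
    unfold cov1
    rw [mul_sub, Finset.mul_sum]
    congr 1
    exact Finset.sum_congr rfl fun e _ => by rw [hG.christoffel_symm hx e b m]; ring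
  have h3 : ∑ m, christoffel G x m a b * cov1 G w x m c
      = ∑ m, christoffel G x m b a * cov1 G w x m c :=
    Finset.sum_congr rfl fun m _ => by rw [hG.christoffel_symm hx]
  unfold cov2
  rw [h1, h1, h2, h2, h3, pd_comm hG.isOpen hx (hw c) a b]
  simp only [riemUp, add_mul, sub_mul, Finset.sum_add_distrib, Finset.sum_sub_distrib,
    Finset.sum_mul]
  ring

end IsMetricOn

/-! ### Symmetries of the curvature and the second Bianchi identity. -/

namespace IsMetricOn

variable {n : ℕ} {G : MetricComp n} {Ω : Set (Coord n)} (hG : IsMetricOn G Ω) {x : Coord n}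
include hG

theorem smooth_riemUp (a b c d : Fin n) : ContDiffOn ℝ ∞ (fun y => riemUp G y a b c d) Ω := by
  unfold riemUp
  exact ((contDiffOn_pd hG.isOpen (hG.smooth_christoffel _ _ _) _).sub
    (contDiffOn_pd hG.isOpen (hG.smooth_christoffel _ _ _) _)).add
    (ContDiffOn.sum fun e _ => ((hG.smooth_christoffel _ _ _).mul (hG.smooth_christoffel _ _ _)).sub
      ((hG.smooth_christoffel _ _ _).mul (hG.smooth_christoffel _ _ _)))

theorem smooth_riem (a b c d : Fin n) : ContDiffOn ℝ ∞ (fun y => riem G y a b c d) Ω := by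
  unfold riem
  exact ContDiffOn.sum fun m _ => (hG.smooth_riemUp _ _ _ _).mul (hG.smooth _ _)

theorem smooth_ric (k l : Fin n) : ContDiffOn ℝ ∞ (fun y => ric G y k l) Ω := by
  unfold ric
  exact ContDiffOn.sum fun a _ => ContDiffOn.sum fun b _ =>
    (hG.smooth_gInv _ _).mul (hG.smooth_riem _ _ _ _)

theorem smooth_scal : ContDiffOn ℝ ∞ (fun y => scal G y) Ω := by
  unfold scal
  exact ContDiffOn.sum fun a _ => ContDiffOn.sum fun b _ =>
    (hG.smooth_gInv _ _).mul (hG.smooth_ric _ _)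

/-- Lowering the last index of `∂Γ` costs a derivative of the metric, which metric compatibility
turns into products of Christoffel symbols. One of these products cancels the quadratic term of
`riemUp`; the other remains with the opposite sign. In this form the index symmetries can be read
off. -/
theorem riem_eq (hx : x ∈ Ω) (a b c d : Fin n) :
    riem G x a b c d = pd b (fun y => christoffelLow G y a c d) x
      - pd a (fun y => christoffelLow G y b c d) x
      - ∑ m, christoffel G x m a c * christoffelLow G x b d m
      + ∑ m, christoffel G x m b c * christoffelLow G x a d m := by
  have hΓd : ∀ m i j, DifferentiableAt ℝ (fun y => christoffel G y m i j) x :=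
    fun m i j => (hG.smooth_christoffel m i j).differentiableAt_of_isOpen hG.isOpen hx
  have hGd : ∀ i j, DifferentiableAt ℝ (fun y => G y i j) x :=
    fun i j => (hG.smooth i j).differentiableAt_of_isOpen hG.isOpen hx
  have h1 : ∀ a b c, pd b (fun y => christoffelLow G y a c d) x
      = ∑ m, pd b (fun y => christoffel G y m a c) x * G x m d
        + (∑ m, christoffel G x m a c * christoffelLow G x b m d
        + ∑ m, christoffel G x m a c * christoffelLow G x b d m) := by
    intro a b c
    rw [← pd_congr hG.isOpen hx (fun y hy => hG.sum_christoffel_mul hy a c d) b,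
      pd_sum (fun m _ => (hΓd _ _ _).fun_mul (hGd _ _)), ← Finset.sum_add_distrib,
      ← Finset.sum_add_distrib]
    refine Finset.sum_congr rfl fun m _ => ?_
    rw [pd_mul (hΓd _ _ _) (hGd _ _), hG.pd_metric hx]
    ring
  have h2 : ∀ a b c, ∑ m, (∑ e, christoffel G x e a c * christoffel G x m e b) * G x m d
      = ∑ m, christoffel G x m a c * christoffelLow G x b m d := by
    intro a b c
    simp only [Finset.sum_mul]
    rw [Finset.sum_comm]
    refine Finset.sum_congr rfl fun e _ => ?_
    rw [← hG.sum_christoffel_mul hx b e d, Finset.mul_sum]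
    exact Finset.sum_congr rfl fun m _ => by rw [hG.christoffel_symm hx m e b]; ring
  rw [h1, h1, ← h2, ← h2]
  simp only [riem, riemUp, add_mul, sub_mul, Finset.sum_add_distrib, Finset.sum_sub_distrib]
  ring

theorem sum_christoffel_mul_christoffelLow_comm (hx : x ∈ Ω) (a b c d : Fin n) :
    ∑ m, christoffel G x m a b * christoffelLow G x c d m
      = ∑ m, christoffel G x m c d * christoffelLow G x a b m := by
  simp only [christoffel_eq, Finset.sum_mul]
  rw [Finset.sum_comm]
  exact Finset.sum_congr rfl fun i _ => Finset.sum_congr rfl fun j _ => by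
    rw [hG.gInv_symm hx]; ring

/-- The two terms `∂ₐ ∂_b g_{cd}` cancel, leaving the usual four second derivatives of the metric.
-/
theorem pd_christoffelLow_sub (hx : x ∈ Ω) (a b c d : Fin n) :
    pd b (fun y => christoffelLow G y a c d) x - pd a (fun y => christoffelLow G y b c d) x
      = (1 / 2) * (pd b (pd c (fun y => G y a d)) x - pd b (pd d (fun y => G y a c)) x
        - pd a (pd c (fun y => G y b d)) x + pd a (pd d (fun y => G y b c)) x) := by
  have hd : ∀ k i j, DifferentiableAt ℝ (pd k fun y => G y i j) x := fun k i j =>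
    (contDiffOn_pd hG.isOpen (hG.smooth i j) k).differentiableAt_of_isOpen hG.isOpen hx
  have h : ∀ a b c d, pd b (fun y => christoffelLow G y a c d) x
      = (1 / 2) * (pd b (pd a (fun y => G y d c)) x + pd b (pd c (fun y => G y a d)) x
        - pd b (pd d (fun y => G y a c)) x) := by
    intro a b c d
    unfold christoffelLow
    rw [pd_const_mul (((hd _ _ _).fun_add (hd _ _ _)).fun_sub (hd _ _ _)),
      pd_sub ((hd _ _ _).fun_add (hd _ _ _)) (hd _ _ _), pd_add (hd _ _ _) (hd _ _ _)]
  rw [h, h, pd_comm hG.isOpen hx (hG.smooth d c) a b]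
  ring

theorem riem_antisymm_right (hx : x ∈ Ω) (a b c d : Fin n) :
    riem G x a b c d = -riem G x a b d c := by
  rw [hG.riem_eq hx, hG.riem_eq hx, hG.pd_christoffelLow_sub hx, hG.pd_christoffelLow_sub hx,
    hG.sum_christoffel_mul_christoffelLow_comm hx a c b d,
    hG.sum_christoffel_mul_christoffelLow_comm hx b c a d]
  ring

theorem riem_pair_symm (hx : x ∈ Ω) (a b c d : Fin n) :
    riem G x a b c d = riem G x c d a b := by
  have hs : ∀ k l i j, pd k (pd l (fun y => G y i j)) x = pd k (pd l (fun y => G y j i)) x :=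
    fun k l i j => pd_congr hG.isOpen hx
      (fun y hy => pd_congr hG.isOpen hy (fun z hz => hG.symm z hz i j) l) k
  have hc : ∀ k l i j, pd k (pd l (fun y => G y i j)) x = pd l (pd k (fun y => G y i j)) x :=
    fun k l i j => pd_comm hG.isOpen hx (hG.smooth i j) k l
  have hL : ∀ i j k l, ∑ m, christoffel G x m i j * christoffelLow G x k l m
      = ∑ m, christoffel G x m j i * christoffelLow G x l k m := fun i j k l =>
    Finset.sum_congr rfl fun m _ => by
      rw [hG.christoffel_symm hx, hG.christoffelLow_symm hx k l]
  rw [hG.riem_eq hx, hG.riem_eq hx, hG.pd_christoffelLow_sub hx, hG.pd_christoffelLow_sub hx,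
    hc d a c b, hs a d c b, hc d b c a, hs b d c a, hc c a d b, hs a c d b, hc c b d a, hs b c d a,
    hL a c b d, hL b c a d,
    hG.sum_christoffel_mul_christoffelLow_comm hx c b d a, hL d a c b]
  ring

theorem ric_symm (hx : x ∈ Ω) (k l : Fin n) : ric G x k l = ric G x l k := by
  unfold ric
  rw [Finset.sum_comm]
  exact Finset.sum_congr rfl fun a _ => Finset.sum_congr rfl fun b _ => by
    rw [hG.gInv_symm hx, hG.riem_pair_symm hx]

/-- Antisymmetry in the last pair moves the lowered index next to the inverse metric, which it
cancels. The result is a trace of `riemUp` with no metric in it, so a change of coordinates needs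
only the inverse Jacobian. -/
theorem ric_eq_neg_trace (hx : x ∈ Ω) (b c : Fin n) :
    ric G x b c = -∑ a, riemUp G x a b c a := by
  unfold ric
  have h : ∀ a d, gInv G x a d * riem G x a b d c
      = -∑ m, riemUp G x a b c m * (gInv G x a d * G x d m) := by
    intro a d
    rw [hG.riem_antisymm_right hx, riem, mul_neg, Finset.mul_sum]
    congr 1
    exact Finset.sum_congr rfl fun m _ => by rw [hG.symm x hx m d]; ring
  simp only [h, Finset.sum_neg_distrib]
  congr 1
  refine Finset.sum_congr rfl fun a _ => ?_
  rw [Finset.sum_comm]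
  simp only [← Finset.mul_sum, hG.sum_gInv_mul hx]
  simp

/-- The second Bianchi identity. -/
theorem bianchi (hx : x ∈ Ω) (a b c k f : Fin n) :
    cov2 G (fun y => riem G y a b) x c k f + cov2 G (fun y => riem G y b c) x a k f
      + cov2 G (fun y => riem G y c a) x b k f = 0 := by
  have hΓs := hG.smooth_christoffel
  have hΓd : ∀ m i j, DifferentiableAt ℝ (fun y => christoffel G y m i j) x :=
    fun m i j => (hΓs m i j).differentiableAt_of_isOpen hG.isOpen hx
  have hΓdd : ∀ k m i j, DifferentiableAt ℝ (pd k fun y => christoffel G y m i j) x :=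
    fun k m i j => (contDiffOn_pd hG.isOpen (hΓs m i j) k).differentiableAt_of_isOpen hG.isOpen hx
  have hGd : ∀ i j, DifferentiableAt ℝ (fun y => G y i j) x :=
    fun i j => (hG.smooth i j).differentiableAt_of_isOpen hG.isOpen hx
  have hRd : ∀ a b c d, DifferentiableAt ℝ (fun y => riemUp G y a b c d) x :=
    fun a b c d => (hG.smooth_riemUp a b c d).differentiableAt_of_isOpen hG.isOpen hx
  -- The first index pair is treated as a pair of form labels, so the curvature becomes the
  -- matrix-valued form `R_{ab} = ∂_b A_a - ∂_a A_b + [A_a, A_b]`. The covariant derivatives in the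
  -- statement act on the last pair only; the omitted connection terms on the labels would cancel in
  -- the cyclic sum.
  let A : Fin n → Matrix (Fin n) (Fin n) ℝ := fun a => Matrix.of fun k e => christoffel G x e a k
  let D : Fin n → Fin n → Matrix (Fin n) (Fin n) ℝ := fun c a =>
    Matrix.of fun k e => pd c (fun y => christoffel G y e a k) x
  let DD : Fin n → Fin n → Fin n → Matrix (Fin n) (Fin n) ℝ := fun c b a =>
    Matrix.of fun k e => pd c (pd b (fun y => christoffel G y e a k)) x
  let R : Fin n → Fin n → Matrix (Fin n) (Fin n) ℝ := fun a b =>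
    Matrix.of fun k e => riemUp G x a b k e
  let DR : Fin n → Fin n → Fin n → Matrix (Fin n) (Fin n) ℝ := fun c a b =>
    Matrix.of fun k e => pd c (fun y => riemUp G y a b k e) x
  have hDD : ∀ c b a, DD c b a = DD b c a := by
    intro c b a
    ext k e
    exact pd_comm hG.isOpen hx (hΓs e a k) c b
  have hR : ∀ a b, R a b = D b a - D a b + A a * A b - A b * A a := by
    intro a b
    ext k e
    simp only [R, D, A, riemUp, Matrix.add_apply, Matrix.sub_apply, Matrix.mul_apply,
      Matrix.of_apply, Finset.sum_sub_distrib]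
    simp only [fun i => hG.christoffel_symm hx e i b, fun i => hG.christoffel_symm hx e i a]
    ring
  have hDR : ∀ c a b, DR c a b = DD c b a - DD c a b + (D c a * A b + A a * D c b)
      - (D c b * A a + A b * D c a) := by
    intro c a b
    ext k e
    simp only [DR, DD, D, A, Matrix.add_apply, Matrix.sub_apply, Matrix.mul_apply,
      Matrix.of_apply]
    have hsd : ∀ a b c d, DifferentiableAt ℝ (fun y => ∑ e, (christoffel G y e a c
        * christoffel G y d e b - christoffel G y e b c * christoffel G y d e a)) x :=
      fun a b c d => DifferentiableAt.fun_sum fun e _ => ((hΓd _ _ _).fun_mul (hΓd _ _ _)).fun_sub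
        ((hΓd _ _ _).fun_mul (hΓd _ _ _))
    unfold riemUp
    rw [pd_add ((hΓdd _ _ _ _).fun_sub (hΓdd _ _ _ _)) (hsd _ _ _ _),
      pd_sub (hΓdd _ _ _ _) (hΓdd _ _ _ _),
      pd_sum fun e _ => ((hΓd _ _ _).fun_mul (hΓd _ _ _)).fun_sub ((hΓd _ _ _).fun_mul (hΓd _ _ _)),
      add_sub_assoc, ← Finset.sum_add_distrib, ← Finset.sum_add_distrib,
      ← Finset.sum_sub_distrib]
    congr 1
    refine Finset.sum_congr rfl fun m _ => ?_
    rw [pd_sub ((hΓd _ _ _).fun_mul (hΓd _ _ _)) ((hΓd _ _ _).fun_mul (hΓd _ _ _)),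
      pd_mul (hΓd _ _ _) (hΓd _ _ _), pd_mul (hΓd _ _ _) (hΓd _ _ _),
      pd_congr hG.isOpen hx (fun y hy => hG.christoffel_symm hy e m b) c,
      pd_congr hG.isOpen hx (fun y hy => hG.christoffel_symm hy e m a) c,
      hG.christoffel_symm hx e m b, hG.christoffel_symm hx e m a]
  have hcov : ∀ c a b, cov2 G (fun y => riem G y a b) x c k f
      = ((DR c a b - A c * R a b + R a b * A c) * G x) k f := by
    intro c a b
    have e1 : pd c (fun y => riem G y a b k f) x
        = ∑ e, pd c (fun y => riemUp G y a b k e) x * G x e f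
          + (∑ e, riemUp G x a b k e * christoffelLow G x c e f
          + ∑ e, riemUp G x a b k e * christoffelLow G x c f e) := by
      unfold riem
      rw [pd_sum fun e _ => (hRd _ _ _ _).fun_mul (hGd _ _), ← Finset.sum_add_distrib,
        ← Finset.sum_add_distrib]
      refine Finset.sum_congr rfl fun e _ => ?_
      rw [pd_mul (hRd _ _ _ _) (hGd _ _), hG.pd_metric hx]
      ring
    have e2 : ∑ m, christoffel G x m c f * riem G x a b k m
        = ∑ e, riemUp G x a b k e * christoffelLow G x c f e := by
      simp only [riem, Finset.mul_sum]
      rw [Finset.sum_comm]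
      refine Finset.sum_congr rfl fun e _ => ?_
      rw [← hG.sum_christoffel_mul hx, Finset.mul_sum]
      exact Finset.sum_congr rfl fun m _ => by rw [hG.symm x hx m e]; ring
    have e3 : ∑ e, riemUp G x a b k e * christoffelLow G x c e f = (R a b * A c * G x) k f := by
      rw [Matrix.mul_assoc, Matrix.mul_apply]
      refine Finset.sum_congr rfl fun e _ => ?_
      rw [← hG.sum_christoffel_mul hx, Matrix.mul_apply]
      rfl
    have e4 : ∑ m, christoffel G x m c k * riem G x a b m f = (A c * R a b * G x) k f := by
      rw [Matrix.mul_assoc, Matrix.mul_apply]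
      refine Finset.sum_congr rfl fun e _ => ?_
      rw [Matrix.mul_apply]
      rfl
    unfold cov2
    rw [e1, e2, e3, e4, Matrix.add_mul, Matrix.sub_mul, Matrix.add_apply, Matrix.sub_apply,
      Matrix.mul_apply (M := DR c a b)]
    simp only [DR, Matrix.of_apply]
    ring
  rw [hcov, hcov, hcov, ← Matrix.add_apply, ← Matrix.add_apply, ← Matrix.add_mul, ← Matrix.add_mul]
  -- The Bianchi identity for matrices: once second partials commute, everything left cancels in a
  -- noncommutative ring.
  have : DR c a b - A c * R a b + R a b * A c + (DR a b c - A a * R b c + R b c * A a)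
      + (DR b c a - A b * R c a + R c a * A b) = 0 := by
    simp only [hDR, hR]
    rw [hDD c b a, hDD a c b, hDD b a c]
    noncomm_ring
  rw [this]
  simp

end IsMetricOn

/-! ### Behaviour of the connection and the curvature under a change of coordinates. -/

/-- The entry `∂ψᵃ/∂xⁱ` of the Jacobian matrix of a change of coordinates. -/
def jac {n : ℕ} (ψ : Coord n → Coord n) (x : Coord n) (a i : Fin n) : ℝ :=
  pd i (fun y => ψ y a) x

/-- `ψ` is a change of coordinates from `Ω` to `Ω'` that pulls the metric `G'` back to `G`. -/
structure IsCoordChange {n : ℕ} (G G' : MetricComp n) (ψ : Coord n → Coord n)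
    (Ω Ω' : Set (Coord n)) : Prop where
  source : IsMetricOn G Ω
  target : IsMetricOn G' Ω'
  mapsTo : Set.MapsTo ψ Ω Ω'
  smooth : ContDiffOn ℝ ∞ ψ Ω
  isUnit_det : ∀ x ∈ Ω, IsUnit (Matrix.of (jac ψ x)).det
  pullback : ∀ x ∈ Ω, ∀ i j, G x i j = ∑ a, ∑ b, jac ψ x a i * jac ψ x b j * G' (ψ x) a b

namespace IsCoordChange

variable {n : ℕ} {G G' : MetricComp n} {ψ : Coord n → Coord n} {Ω Ω' : Set (Coord n)}
  (h : IsCoordChange G G' ψ Ω Ω') {x : Coord n}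
include h

theorem smooth_coord (a : Fin n) : ContDiffOn ℝ ∞ (fun y => ψ y a) Ω :=
  (EuclideanSpace.proj a : Coord n →L[ℝ] ℝ).contDiff.comp_contDiffOn h.smooth

theorem smooth_jac (a i : Fin n) : ContDiffOn ℝ ∞ (fun y => jac ψ y a i) Ω :=
  contDiffOn_pd h.source.isOpen (h.smooth_coord a) i

theorem differentiableAt_jac (hx : x ∈ Ω) (a i : Fin n) :
    DifferentiableAt ℝ (fun y => jac ψ y a i) x :=
  (h.smooth_jac a i).differentiableAt_of_isOpen h.source.isOpen hx

theorem differentiableAt (hx : x ∈ Ω) : DifferentiableAt ℝ ψ x :=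
  (h.smooth.contDiffAt (h.source.isOpen.mem_nhds hx)).differentiableAt (by simp)

theorem smooth_comp {F : Coord n → ℝ} (hF : ContDiffOn ℝ ∞ F Ω') :
    ContDiffOn ℝ ∞ (fun y => F (ψ y)) Ω :=
  hF.comp h.smooth h.mapsTo

theorem differentiableAt_comp {F : Coord n → ℝ} (hF : ContDiffOn ℝ ∞ F Ω') (hx : x ∈ Ω) :
    DifferentiableAt ℝ (fun y => F (ψ y)) x :=
  (h.smooth_comp hF).differentiableAt_of_isOpen h.source.isOpen hx

theorem pd_comp {F : Coord n → ℝ} (hF : ContDiffOn ℝ ∞ F Ω') (hx : x ∈ Ω) (i : Fin n) :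
    pd i (fun y => F (ψ y)) x = ∑ a, jac ψ x a i * pd a F (ψ x) :=
  QuadraticGravity.pd_comp (hF.differentiableAt_of_isOpen h.target.isOpen (h.mapsTo hx))
    (h.differentiableAt hx) i

theorem pd_jac_symm (hx : x ∈ Ω) (a i j : Fin n) :
    pd i (fun y => jac ψ y a j) x = pd j (fun y => jac ψ y a i) x :=
  pd_comm h.source.isOpen hx (h.smooth_coord a) i j

/-- The derivative of the pullback of a tensor field of rank two. -/
theorem pd_pullback {S' : Coord n → Fin n → Fin n → ℝ}
    (hS' : ∀ a b, ContDiffOn ℝ ∞ (fun y => S' y a b) Ω') (hx : x ∈ Ω) (s i j : Fin n) :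
    pd s (fun y => ∑ a, ∑ b, jac ψ y a i * jac ψ y b j * S' (ψ y) a b) x
      = ∑ a, ∑ b, pd s (fun y => jac ψ y a i) x * jac ψ x b j * S' (ψ x) a b
        + ∑ a, ∑ b, jac ψ x a i * pd s (fun y => jac ψ y b j) x * S' (ψ x) a b
        + ∑ a, ∑ b, jac ψ x a i * jac ψ x b j *
            ∑ c, jac ψ x c s * pd c (fun y => S' y a b) (ψ x) := by
  have hJ := fun a i => h.differentiableAt_jac hx a i
  have hS := fun a b => h.differentiableAt_comp (hS' a b) hx
  rw [pd_sum fun a _ => DifferentiableAt.fun_sum fun b _ =>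
      ((hJ _ _).fun_mul (hJ _ _)).fun_mul (hS _ _),
    ← Finset.sum_add_distrib, ← Finset.sum_add_distrib]
  refine Finset.sum_congr rfl fun a _ => ?_
  rw [pd_sum fun b _ => ((hJ _ _).fun_mul (hJ _ _)).fun_mul (hS _ _),
    ← Finset.sum_add_distrib, ← Finset.sum_add_distrib]
  refine Finset.sum_congr rfl fun b _ => ?_
  rw [pd_mul ((hJ _ _).fun_mul (hJ _ _)) (hS _ _), pd_mul (hJ _ _) (hJ _ _),
    h.pd_comp (hS' a b) hx]
  ring

/-- The transformation law of the Christoffel symbols. -/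
theorem sum_jac_mul_christoffel (hx : x ∈ Ω) (k i j : Fin n) :
    ∑ m, jac ψ x k m * christoffel G x m i j = pd i (fun y => jac ψ y k j) x
      + ∑ a, ∑ b, christoffel G' (ψ x) k a b * jac ψ x a i * jac ψ x b j := by
  have hy := h.mapsTo hx
  -- The argument is uniqueness of the Levi-Civita connection. The candidate `V` is symmetric in
  -- `i`, `j`, and with `W = G' J` the derivative of the metric splits as `V W + V W`; the formula
  -- for the lowered Christoffel symbols then identifies them with `V W`.
  set V : Fin n → Fin n → Fin n → ℝ := fun k i j => pd i (fun y => jac ψ y k j) x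
      + ∑ a, ∑ b, christoffel G' (ψ x) k a b * jac ψ x a i * jac ψ x b j with hV
  have hVs : ∀ k i j, V k i j = V k j i := by
    intro k i j
    simp only [hV]
    rw [h.pd_jac_symm hx, Finset.sum_comm]
    congr 1
    exact Finset.sum_congr rfl fun a _ => Finset.sum_congr rfl fun b _ => by
      rw [h.target.christoffel_symm hy]; ring
  set W : Matrix (Fin n) (Fin n) ℝ := G' (ψ x) * Matrix.of (jac ψ x) with hW
  have hVW : ∀ i j s, ∑ k, V k i j * W k s
      = ∑ a, ∑ b, pd i (fun y => jac ψ y a j) x * jac ψ x b s * G' (ψ x) a b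
        + ∑ b, ∑ a, ∑ c, christoffelLow G' (ψ x) c a b * jac ψ x c i * jac ψ x a j
            * jac ψ x b s := by
    intro i j s
    have e1 : ∀ k, V k i j * W k s = ∑ b, pd i (fun y => jac ψ y k j) x * jac ψ x b s * G' (ψ x) k b
        + ∑ b, ∑ a, ∑ c, (christoffel G' (ψ x) k c a * G' (ψ x) k b) * jac ψ x c i * jac ψ x a j
            * jac ψ x b s := by
      intro k
      simp only [hV, hW, Matrix.mul_apply, Matrix.of_apply, Finset.mul_sum]
      rw [← Finset.sum_add_distrib]
      refine Finset.sum_congr rfl fun b _ => ?_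
      rw [add_mul, Finset.sum_mul, Finset.sum_comm]
      congr 1
      · ring
      · refine Finset.sum_congr rfl fun a _ => ?_
        rw [Finset.sum_mul]
        exact Finset.sum_congr rfl fun c _ => by ring
    simp only [e1, Finset.sum_add_distrib]
    congr 1
    rw [Finset.sum_comm]
    refine Finset.sum_congr rfl fun b _ => ?_
    rw [Finset.sum_comm]
    refine Finset.sum_congr rfl fun a _ => ?_
    rw [Finset.sum_comm]
    refine Finset.sum_congr rfl fun c _ => ?_
    rw [← h.target.sum_christoffel_mul hy]
    simp only [Finset.sum_mul]
  have hG : ∀ s i j, pd s (fun y => G y i j) x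
      = ∑ k, V k s i * W k j + ∑ k, V k s j * W k i := by
    intro s i j
    rw [pd_congr h.source.isOpen hx (fun y hy => h.pullback y hy i j) s,
      h.pd_pullback h.target.smooth hx, hVW, hVW]
    have e1 : ∑ a, ∑ b, jac ψ x a i * pd s (fun y => jac ψ y b j) x * G' (ψ x) a b
        = ∑ a, ∑ b, pd s (fun y => jac ψ y a j) x * jac ψ x b i * G' (ψ x) a b := by
      rw [Finset.sum_comm]
      exact Finset.sum_congr rfl fun a _ => Finset.sum_congr rfl fun b _ => by
        rw [h.target.symm _ hy]; ring
    have e2 : ∑ a, ∑ b, jac ψ x a i * jac ψ x b j *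
            ∑ c, jac ψ x c s * pd c (fun y => G' y a b) (ψ x)
        = ∑ b, ∑ a, ∑ c, christoffelLow G' (ψ x) c a b * jac ψ x c s * jac ψ x a i * jac ψ x b j
          + ∑ b, ∑ a, ∑ c, christoffelLow G' (ψ x) c a b * jac ψ x c s * jac ψ x a j
            * jac ψ x b i := by
      conv_rhs => enter [1]; rw [Finset.sum_comm]
      rw [← Finset.sum_add_distrib]
      refine Finset.sum_congr rfl fun a _ => ?_
      rw [← Finset.sum_add_distrib]
      refine Finset.sum_congr rfl fun b _ => ?_
      rw [Finset.mul_sum, ← Finset.sum_add_distrib]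
      refine Finset.sum_congr rfl fun c _ => ?_
      rw [h.target.pd_metric hy]
      ring
    rw [e1, e2]
    ring
  have hlow : ∀ s, christoffelLow G x i j s = ∑ k, V k i j * W k s := by
    intro s
    unfold christoffelLow
    rw [hG, hG, hG]
    have hs : ∀ i j s, ∑ k, V k i j * W k s = ∑ k, V k j i * W k s := fun i j s =>
      Finset.sum_congr rfl fun k _ => by rw [hVs]
    rw [hs j i s, hs j s i, hs i s j]
    ring
  have hWu : IsUnit W := by
    rw [Matrix.isUnit_iff_isUnit_det, hW, Matrix.det_mul]
    exact (h.target.isUnit_det _ hy).mul (h.isUnit_det x hx)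
  have hGW : ∀ m s, G x m s = ∑ k, jac ψ x k m * W k s := by
    intro m s
    rw [h.pullback x hx]
    simp only [hW, Matrix.mul_apply, Matrix.of_apply, Finset.mul_sum]
    exact Finset.sum_congr rfl fun a _ => Finset.sum_congr rfl fun b _ => by ring
  -- Since `G = Jᵀ W`, both sides of the claim have the same product with the invertible matrix `W`.
  have hvec : Matrix.vecMul (fun k => ∑ m, jac ψ x k m * christoffel G x m i j) W
      = Matrix.vecMul (fun k => V k i j) W := by
    ext s
    simp only [Matrix.vecMul, dotProduct]
    rw [← hlow, ← h.source.sum_christoffel_mul hx]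
    simp only [hGW, Finset.sum_mul, Finset.mul_sum]
    rw [Finset.sum_comm]
    exact Finset.sum_congr rfl fun a _ => Finset.sum_congr rfl fun b _ => by ring
  exact congrFun (Matrix.vecMul_injective_of_isUnit hWu hvec) k

/-- The transformation law of the covariant derivative of a covector field. -/
theorem cov1_pullback {w w' : Coord n → Fin n → ℝ}
    (hw' : ∀ a, ContDiffOn ℝ ∞ (fun y => w' y a) Ω')
    (hw : ∀ x ∈ Ω, ∀ k, w x k = ∑ a, jac ψ x a k * w' (ψ x) a) (hx : x ∈ Ω) (i k : Fin n) :
    cov1 G w x i k = ∑ a, ∑ b, jac ψ x a i * jac ψ x b k * cov1 G' w' (ψ x) a b := by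
  have hJ := fun a i => h.differentiableAt_jac hx a i
  have hS := fun a => h.differentiableAt_comp (hw' a) hx
  unfold cov1
  rw [pd_congr h.source.isOpen hx (fun y hy => hw y hy k) i,
    pd_sum fun a _ => (hJ _ _).fun_mul (hS _)]
  have e1 : ∑ m, christoffel G x m i k * w x m
      = ∑ b, (pd i (fun y => jac ψ y b k) x
        + ∑ a, ∑ c, christoffel G' (ψ x) b a c * jac ψ x a i * jac ψ x c k) * w' (ψ x) b := by
    simp only [← h.sum_jac_mul_christoffel hx, hw x hx, Finset.mul_sum, Finset.sum_mul]
    rw [Finset.sum_comm]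
    exact Finset.sum_congr rfl fun a _ => Finset.sum_congr rfl fun b _ => by ring
  have e2 : ∑ a, ∑ b, jac ψ x a i * jac ψ x b k
        * (pd a (fun y => w' y b) (ψ x) - ∑ m, christoffel G' (ψ x) m a b * w' (ψ x) m)
      = ∑ b, ∑ a, jac ψ x a i * jac ψ x b k * pd a (fun y => w' y b) (ψ x)
        - ∑ b, ∑ a, ∑ c, christoffel G' (ψ x) b a c * jac ψ x a i * jac ψ x c k * w' (ψ x) b := by
    simp only [mul_sub, Finset.sum_sub_distrib, Finset.mul_sum]
    congr 1
    · rw [Finset.sum_comm]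
    · refine (Finset.sum_congr rfl fun _ _ => Finset.sum_comm).trans (Finset.sum_comm.trans ?_)
      exact Finset.sum_congr rfl fun b _ => Finset.sum_congr rfl fun a _ =>
        Finset.sum_congr rfl fun c _ => by ring
  rw [e1, e2]
  simp only [add_mul, Finset.sum_add_distrib, Finset.sum_mul]
  have e3 : ∑ a, pd i (fun y => jac ψ y a k * w' (ψ y) a) x
      = ∑ b, pd i (fun y => jac ψ y b k) x * w' (ψ x) b
        + ∑ b, ∑ a, jac ψ x a i * jac ψ x b k * pd a (fun y => w' y b) (ψ x) := by
    rw [← Finset.sum_add_distrib]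
    refine Finset.sum_congr rfl fun a _ => ?_
    rw [pd_mul (hJ _ _) (hS _), h.pd_comp (hw' a) hx, Finset.mul_sum]
    congr 1
    exact Finset.sum_congr rfl fun b _ => by ring
  rw [e3]
  ring

/-- The transformation law of the covariant derivative of a tensor field of rank two. -/
theorem cov2_pullback {S S' : Coord n → Fin n → Fin n → ℝ}
    (hS' : ∀ a b, ContDiffOn ℝ ∞ (fun y => S' y a b) Ω')
    (hS : ∀ x ∈ Ω, ∀ k l, S x k l = ∑ a, ∑ b, jac ψ x a k * jac ψ x b l * S' (ψ x) a b)
    (hx : x ∈ Ω) (i k l : Fin n) :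
    cov2 G S x i k l = ∑ c, ∑ a, ∑ b,
      jac ψ x c i * jac ψ x a k * jac ψ x b l * cov2 G' S' (ψ x) c a b := by
  have hΓ := fun k i j => h.sum_jac_mul_christoffel hx k i j
  have e1 : ∑ m, christoffel G x m i k * S x m l
      = ∑ a, ∑ b, pd i (fun y => jac ψ y a k) x * jac ψ x b l * S' (ψ x) a b
        + ∑ a, ∑ b, (∑ c, ∑ e, christoffel G' (ψ x) a c e * jac ψ x c i * jac ψ x e k)
            * jac ψ x b l * S' (ψ x) a b := by
    rw [← Finset.sum_add_distrib]
    simp only [← Finset.sum_add_distrib, ← add_mul, ← hΓ]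
    simp only [hS x hx, Finset.mul_sum, Finset.sum_mul]
    rw [Finset.sum_comm]
    refine Finset.sum_congr rfl fun a _ => ?_
    rw [Finset.sum_comm]
    exact Finset.sum_congr rfl fun b _ => Finset.sum_congr rfl fun m _ => by ring
  have e2 : ∑ m, christoffel G x m i l * S x k m
      = ∑ a, ∑ b, jac ψ x a k * pd i (fun y => jac ψ y b l) x * S' (ψ x) a b
        + ∑ a, ∑ b, jac ψ x a k * (∑ c, ∑ e, christoffel G' (ψ x) b c e * jac ψ x c i * jac ψ x e l)
            * S' (ψ x) a b := by
    rw [← Finset.sum_add_distrib]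
    simp only [← Finset.sum_add_distrib, ← add_mul, ← mul_add, ← hΓ]
    simp only [hS x hx, Finset.mul_sum, Finset.sum_mul]
    rw [Finset.sum_comm]
    refine Finset.sum_congr rfl fun a _ => ?_
    rw [Finset.sum_comm]
    exact Finset.sum_congr rfl fun b _ => Finset.sum_congr rfl fun m _ => by ring
  unfold cov2
  rw [pd_congr h.source.isOpen hx (fun y hy => hS y hy k l) i, h.pd_pullback hS' hx, e1, e2]
  simp only [mul_sub, Finset.sum_sub_distrib]
  have e3 : ∑ a, ∑ b, jac ψ x a k * jac ψ x b l * ∑ c, jac ψ x c i * pd c (fun y => S' y a b) (ψ x)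
      = ∑ c, ∑ a, ∑ b, jac ψ x c i * jac ψ x a k * jac ψ x b l * pd c (fun y => S' y a b) (ψ x) := by
    simp only [Finset.mul_sum]
    refine (Finset.sum_congr rfl fun _ _ => Finset.sum_comm).trans (Finset.sum_comm.trans ?_)
    exact Finset.sum_congr rfl fun c _ => Finset.sum_congr rfl fun a _ =>
      Finset.sum_congr rfl fun b _ => by ring
  have e4 : ∑ a, ∑ b, (∑ c, ∑ e, christoffel G' (ψ x) a c e * jac ψ x c i * jac ψ x e k)
            * jac ψ x b l * S' (ψ x) a b
      = ∑ c, ∑ a, ∑ b, jac ψ x c i * jac ψ x a k * jac ψ x b l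
          * ∑ m, christoffel G' (ψ x) m c a * S' (ψ x) m b := by
    simp only [Finset.mul_sum, Finset.sum_mul]
    have : ∀ a, ∑ b, ∑ c, ∑ e, christoffel G' (ψ x) a c e * jac ψ x c i * jac ψ x e k
          * jac ψ x b l * S' (ψ x) a b
        = ∑ c, ∑ e, ∑ b, jac ψ x c i * jac ψ x e k * jac ψ x b l
          * (christoffel G' (ψ x) a c e * S' (ψ x) a b) := by
      intro a
      rw [Finset.sum_comm]
      refine Finset.sum_congr rfl fun c _ => ?_
      rw [Finset.sum_comm]
      exact Finset.sum_congr rfl fun e _ => Finset.sum_congr rfl fun b _ => by ring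
    simp only [this]
    rw [Finset.sum_comm]
    refine Finset.sum_congr rfl fun c _ => ?_
    rw [Finset.sum_comm]
    refine Finset.sum_congr rfl fun e _ => ?_
    rw [Finset.sum_comm]
  have e5 : ∑ a, ∑ b, jac ψ x a k
        * (∑ c, ∑ e, christoffel G' (ψ x) b c e * jac ψ x c i * jac ψ x e l) * S' (ψ x) a b
      = ∑ c, ∑ a, ∑ b, jac ψ x c i * jac ψ x a k * jac ψ x b l
          * ∑ m, christoffel G' (ψ x) m c b * S' (ψ x) a m := by
    simp only [Finset.mul_sum, Finset.sum_mul]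
    rw [Finset.sum_comm (s := Finset.univ) (t := Finset.univ) (f := fun c a => ∑ b, ∑ m,
      jac ψ x c i * jac ψ x a k * jac ψ x b l
          * (christoffel G' (ψ x) m c b * S' (ψ x) a m))]
    refine Finset.sum_congr rfl fun a _ => ?_
    rw [Finset.sum_comm]
    refine Finset.sum_congr rfl fun c _ => ?_
    rw [Finset.sum_comm]
    exact Finset.sum_congr rfl fun e _ => Finset.sum_congr rfl fun b _ => by ring
  rw [e3, e4, e5]
  ring

/-- The transformation law of the curvature. -/
theorem sum_riemUp_mul_jac (hx : x ∈ Ω) (a b c d : Fin n) :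
    ∑ m, riemUp G x a b c m * jac ψ x d m
      = ∑ i, ∑ j, ∑ k, jac ψ x i a * jac ψ x j b * jac ψ x k c * riemUp G' (ψ x) i j k d := by
  -- The covector field `w'` is the differential of the `d`-th target coordinate, and its pullback
  -- `w` is row `d` of the Jacobian. Comparing the Ricci identities of the two fields gives the law
  -- without differentiating transformed Christoffel symbols.
  let w' : Coord n → Fin n → ℝ := fun _ m => if m = d then 1 else 0
  let w : Coord n → Fin n → ℝ := fun y m => jac ψ y d m
  have hw' : ∀ a, ContDiffOn ℝ ∞ (fun y => w' y a) Ω' := fun a => contDiffOn_const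
  have hw : ∀ x ∈ Ω, ∀ k, w x k = ∑ a, jac ψ x a k * w' (ψ x) a := by
    intro x hx k
    simp [w, w']
  have h1 := h.source.cov2_cov1_sub (w := w) (fun k => h.smooth_jac d k) hx a b c
  have h2 := fun i j k => h.target.cov2_cov1_sub hw' (h.mapsTo hx) i j k
  have h3 := fun i k l => h.cov2_pullback (S := cov1 G w) (S' := cov1 G' w')
    (fun a b => h.target.smooth_cov1 hw' a b) (fun x hx i k => h.cov1_pullback hw' hw hx i k)
    hx i k l
  rw [← h1, h3, h3, Finset.sum_comm (s := Finset.univ) (t := Finset.univ) (f := fun c' a' => ∑ b',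
      jac ψ x c' b * jac ψ x a' a * jac ψ x b' c * cov2 G' (cov1 G' w') (ψ x) c' a' b')]
  simp only [← Finset.sum_sub_distrib]
  refine Finset.sum_congr rfl fun i _ => Finset.sum_congr rfl fun j _ =>
    Finset.sum_congr rfl fun k _ => ?_
  have : riemUp G' (ψ x) i j k d = ∑ m, riemUp G' (ψ x) i j k m * w' (ψ x) m := by simp [w']
  rw [this, ← h2]
  ring

/-- The transformation law of the Ricci tensor. -/
theorem ric_pullback (hx : x ∈ Ω) (b c : Fin n) :
    ric G x b c = ∑ j, ∑ k, jac ψ x j b * jac ψ x k c * ric G' (ψ x) j k := by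
  set J := Matrix.of (jac ψ x) with hJ
  have hJu := h.isUnit_det x hx
  have hJK : ∀ a m, ∑ d, J⁻¹ a d * jac ψ x d m = if a = m then 1 else 0 := by
    intro a m
    have := congrFun (congrFun (Matrix.nonsing_inv_mul J hJu) a) m
    simpa [Matrix.mul_apply, Matrix.one_apply, hJ] using this
  have hKJ : ∀ a m, ∑ d, jac ψ x a d * J⁻¹ d m = if a = m then 1 else 0 := by
    intro a m
    have := congrFun (congrFun (Matrix.mul_nonsing_inv J hJu) a) m
    simpa [Matrix.mul_apply, Matrix.one_apply, hJ] using this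
  have e1 : ∀ a, riemUp G x a b c a = ∑ j, ∑ k, ∑ i, ∑ d, jac ψ x j b * jac ψ x k c
      * (riemUp G' (ψ x) i j k d * (jac ψ x i a * J⁻¹ a d)) := by
    intro a
    -- The inserted `J⁻¹ J` supplies the Jacobian factor on the upper index that the transformation
    -- law requires; the remaining `J⁻¹` cancels against the Jacobian of the traced index.
    have : riemUp G x a b c a = ∑ m, riemUp G x a b c m * ∑ d, J⁻¹ a d * jac ψ x d m := by
      simp [hJK]
    rw [this]
    have : ∑ m, riemUp G x a b c m * ∑ d, J⁻¹ a d * jac ψ x d m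
        = ∑ d, J⁻¹ a d * ∑ m, riemUp G x a b c m * jac ψ x d m := by
      simp only [Finset.mul_sum]
      rw [Finset.sum_comm]
      exact Finset.sum_congr rfl fun d _ => Finset.sum_congr rfl fun m _ => by ring
    rw [this]
    simp only [h.sum_riemUp_mul_jac hx, Finset.mul_sum]
    rw [Finset.sum_comm, Finset.sum_congr rfl fun i _ => Finset.sum_comm, Finset.sum_comm]
    refine Finset.sum_congr rfl fun j _ => ?_
    rw [Finset.sum_congr rfl fun i _ => Finset.sum_comm, Finset.sum_comm]
    exact Finset.sum_congr rfl fun k _ => Finset.sum_congr rfl fun i _ =>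
      Finset.sum_congr rfl fun d _ => by ring
  rw [h.source.ric_eq_neg_trace hx]
  simp only [h.target.ric_eq_neg_trace (h.mapsTo hx), e1]
  rw [Finset.sum_comm, ← Finset.sum_neg_distrib]
  refine Finset.sum_congr rfl fun j _ => ?_
  rw [Finset.sum_comm, ← Finset.sum_neg_distrib]
  refine Finset.sum_congr rfl fun k _ => ?_
  rw [Finset.sum_comm, mul_neg, Finset.mul_sum]
  congr 1
  refine Finset.sum_congr rfl fun i _ => ?_
  rw [Finset.sum_comm]
  simp only [← Finset.mul_sum, hKJ]
  simp

end IsCoordChange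

/-! ### Product rules for covariant derivatives. -/

section Leibniz

variable {n : ℕ} {G : MetricComp n} {x : Coord n}

theorem cov1_smul {f : Coord n → ℝ} {w : Coord n → Fin n → ℝ} (hf : DifferentiableAt ℝ f x)
    (hw : ∀ k, DifferentiableAt ℝ (fun y => w y k) x) (a k : Fin n) :
    cov1 G (fun y k => f y * w y k) x a k = pd a f x * w x k + f x * cov1 G w x a k := by
  unfold cov1
  rw [pd_mul hf (hw k), mul_sub, Finset.mul_sum, add_sub_assoc]
  congr 2
  exact Finset.sum_congr rfl fun m _ => by ring

theorem cov2_add {S T : Coord n → Fin n → Fin n → ℝ}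
    (hS : ∀ k l, DifferentiableAt ℝ (fun y => S y k l) x)
    (hT : ∀ k l, DifferentiableAt ℝ (fun y => T y k l) x) (a k l : Fin n) :
    cov2 G (fun y k l => S y k l + T y k l) x a k l = cov2 G S x a k l + cov2 G T x a k l := by
  unfold cov2
  rw [pd_add (hS k l) (hT k l)]
  simp only [mul_add, Finset.sum_add_distrib]
  ring

theorem cov2_smul {f : Coord n → ℝ} {S : Coord n → Fin n → Fin n → ℝ}
    (hf : DifferentiableAt ℝ f x) (hS : ∀ k l, DifferentiableAt ℝ (fun y => S y k l) x)
    (a k l : Fin n) :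
    cov2 G (fun y k l => f y * S y k l) x a k l = pd a f x * S x k l + f x * cov2 G S x a k l := by
  unfold cov2
  rw [pd_mul hf (hS k l)]
  simp only [mul_left_comm _ (f x), ← Finset.mul_sum]
  ring

theorem cov2_tmul {v w : Coord n → Fin n → ℝ} (hv : ∀ k, DifferentiableAt ℝ (fun y => v y k) x)
    (hw : ∀ k, DifferentiableAt ℝ (fun y => w y k) x) (a k l : Fin n) :
    cov2 G (fun y k l => v y k * w y l) x a k l
      = cov1 G v x a k * w x l + v x k * cov1 G w x a l := by
  unfold cov2 cov1
  rw [pd_mul (hv k) (hw l)]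
  simp only [mul_left_comm _ (v x k), ← mul_assoc, ← Finset.sum_mul]
  simp only [mul_assoc, ← Finset.mul_sum]
  ring

theorem cov3_add {S T : Coord n → Fin n → Fin n → Fin n → ℝ}
    (hS : ∀ b k l, DifferentiableAt ℝ (fun y => S y b k l) x)
    (hT : ∀ b k l, DifferentiableAt ℝ (fun y => T y b k l) x) (a b k l : Fin n) :
    cov3 G (fun y b k l => S y b k l + T y b k l) x a b k l
      = cov3 G S x a b k l + cov3 G T x a b k l := by
  unfold cov3
  rw [pd_add (hS b k l) (hT b k l)]
  simp only [mul_add, Finset.sum_add_distrib]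
  ring

theorem cov3_smul {f : Coord n → ℝ} {S : Coord n → Fin n → Fin n → Fin n → ℝ}
    (hf : DifferentiableAt ℝ f x) (hS : ∀ b k l, DifferentiableAt ℝ (fun y => S y b k l) x)
    (a b k l : Fin n) :
    cov3 G (fun y b k l => f y * S y b k l) x a b k l
      = pd a f x * S x b k l + f x * cov3 G S x a b k l := by
  unfold cov3
  rw [pd_mul hf (hS b k l)]
  simp only [mul_left_comm _ (f x), ← Finset.mul_sum]
  ring

theorem cov3_swap {S : Coord n → Fin n → Fin n → Fin n → ℝ} (a b k l : Fin n) :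
    cov3 G (fun y b k l => S y b l k) x a b k l = cov3 G S x a b l k := by
  unfold cov3
  ring

theorem cov3_tmul {v : Coord n → Fin n → ℝ} {S : Coord n → Fin n → Fin n → ℝ}
    (hv : ∀ k, DifferentiableAt ℝ (fun y => v y k) x)
    (hS : ∀ k l, DifferentiableAt ℝ (fun y => S y k l) x) (a b k l : Fin n) :
    cov3 G (fun y b k l => v y b * S y k l) x a b k l
      = cov1 G v x a b * S x k l + v x b * cov2 G S x a k l := by
  unfold cov3 cov2 cov1
  rw [pd_mul (hv b) (hS k l)]
  simp only [mul_left_comm _ (v x b), ← mul_assoc, ← Finset.sum_mul]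
  simp only [mul_assoc, ← Finset.mul_sum]
  ring

theorem cov3_tmul' {v : Coord n → Fin n → ℝ} {S : Coord n → Fin n → Fin n → ℝ}
    (hv : ∀ k, DifferentiableAt ℝ (fun y => v y k) x)
    (hS : ∀ k l, DifferentiableAt ℝ (fun y => S y k l) x) (a b k l : Fin n) :
    cov3 G (fun y b k l => S y b k * v y l) x a b k l
      = cov2 G S x a b k * v x l + S x b k * cov1 G v x a l := by
  unfold cov3 cov2 cov1
  rw [pd_mul (hS b k) (hv l)]
  simp only [mul_left_comm _ (S x b k), ← mul_assoc, ← Finset.sum_mul]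
  simp only [mul_assoc, ← Finset.mul_sum]
  ring

theorem cov1_congr {Ω : Set (Coord n)} (hΩ : IsOpen Ω) (hx : x ∈ Ω) {v w : Coord n → Fin n → ℝ}
    (h : ∀ y ∈ Ω, v y = w y) (a k : Fin n) : cov1 G v x a k = cov1 G w x a k := by
  unfold cov1
  rw [pd_congr hΩ hx (fun y hy => congrFun (h y hy) k), h x hx]

theorem cov2_congr {Ω : Set (Coord n)} (hΩ : IsOpen Ω) (hx : x ∈ Ω)
    {S T : Coord n → Fin n → Fin n → ℝ} (h : ∀ y ∈ Ω, S y = T y) (a k l : Fin n) :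
    cov2 G S x a k l = cov2 G T x a k l := by
  unfold cov2
  rw [pd_congr hΩ hx (fun y hy => congrFun (congrFun (h y hy) k) l), h x hx]

theorem cov3_congr {Ω : Set (Coord n)} (hΩ : IsOpen Ω) (hx : x ∈ Ω)
    {S T : Coord n → Fin n → Fin n → Fin n → ℝ} (h : ∀ y ∈ Ω, S y = T y) (a b k l : Fin n) :
    cov3 G S x a b k l = cov3 G T x a b k l := by
  unfold cov3
  rw [pd_congr hΩ hx (fun y hy => congrFun (congrFun (congrFun (h y hy) b) k) l), h x hx]

end Leibniz

/-! ### Contractions of perfect fluid tensors. -/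

section Algebra

variable {n : ℕ} {G : MetricComp n} {Ω : Set (Coord n)} {x : Coord n}

/-- Contraction with the inverse metric. -/
def contr (G : MetricComp n) (x : Coord n) (F : Fin n → Fin n → ℝ) : ℝ :=
  ∑ a, ∑ b, gInv G x a b * F a b

theorem contr_add (F H : Fin n → Fin n → ℝ) :
    contr G x (fun a b => F a b + H a b) = contr G x F + contr G x H := by
  simp [contr, mul_add, Finset.sum_add_distrib]

theorem contr_sub (F H : Fin n → Fin n → ℝ) :
    contr G x (fun a b => F a b - H a b) = contr G x F - contr G x H := by
  simp [contr, mul_sub, Finset.sum_sub_distrib]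

theorem contr_mul_left (c : ℝ) (F : Fin n → Fin n → ℝ) :
    contr G x (fun a b => c * F a b) = c * contr G x F := by
  simp only [contr, Finset.mul_sum]
  exact Finset.sum_congr rfl fun a _ => Finset.sum_congr rfl fun b _ => by ring

theorem IsMetricOn.contr_metric (hG : IsMetricOn G Ω) (hx : x ∈ Ω) :
    contr G x (fun a b => G x a b) = n := by
  unfold contr
  simp [fun a => show ∑ b, gInv G x a b * G x a b = 1 by
    simp only [hG.symm x hx a]; rw [hG.sum_gInv_mul hx]; simp]

theorem IsMetricOn.contr_symm (hG : IsMetricOn G Ω) (hx : x ∈ Ω) (F : Fin n → Fin n → ℝ) :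
    contr G x (fun a b => F b a) = contr G x F := by
  unfold contr
  rw [Finset.sum_comm]
  exact Finset.sum_congr rfl fun a _ => Finset.sum_congr rfl fun b _ => by rw [hG.gInv_symm hx]

theorem IsMetricOn.contr_metric_mul (hG : IsMetricOn G Ω) (hx : x ∈ Ω) (k : Fin n)
    (X : Fin n → ℝ) : contr G x (fun a b => G x k a * X b) = X k := by
  unfold contr
  rw [Finset.sum_comm]
  have : ∀ b, ∑ a, gInv G x a b * (G x k a * X b) = X b * if k = b then 1 else 0 := by
    intro b
    rw [← hG.sum_mul_gInv hx, Finset.mul_sum]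
    exact Finset.sum_congr rfl fun a _ => by ring
  simp [this]

variable {u : Fin n → ℝ} (hG : IsMetricOn G Ω) (hx : x ∈ Ω)
  (hu : contr G x (fun a b => u a * u b) = -1)
include hG hx hu

theorem contr_perfectFluid (A B : ℝ) :
    contr G x (fun a b => A * G x a b + B * (u a * u b)) = n * A - B := by
  rw [contr_add, contr_mul_left A (fun a b => G x a b), contr_mul_left, hG.contr_metric hx, hu]
  ring

/-- Closure of perfect fluids under contracted products. The term `-B B'` comes from `uₐ uᵃ = -1`.
-/
theorem contr_perfectFluid_mul (A B A' B' : ℝ) (k l : Fin n) :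
    contr G x (fun a b => (A * G x k a + B * (u k * u a)) * (A' * G x l b + B' * (u l * u b)))
      = A * A' * G x k l + (A * B' + B * A' - B * B') * (u k * u l) := by
  have e : (fun a b => (A * G x k a + B * (u k * u a)) * (A' * G x l b + B' * (u l * u b)))
      = fun a b => (A * A') * (G x k a * G x l b) + (A * B' * u l) * (G x k a * u b)
        + (B * A' * u k) * (G x l b * u a) + (B * B' * u k * u l) * (u a * u b) := by
    ext a b; ring
  rw [e, contr_add, contr_add, contr_add, contr_mul_left, contr_mul_left, contr_mul_left,
    contr_mul_left, hG.contr_metric_mul hx k (fun b => G x l b), hG.contr_metric_mul hx, hu,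
    hG.contr_symm hx (fun a b => G x l a * u b), hG.contr_metric_mul hx, hG.symm x hx l k]
  ring

/-- With `X`, `Y`, `X'`, `Y'` the four perfect fluids, each factor has the form `X_{kd} Y_{ce} -
X_{ke} Y_{cd}`. Of the four products in the expansion, the two diagonal ones agree and so do the two
mixed ones, since `d` and `e` are both summed. What remains is twice `(X X')_{kl} tr(Y Y')` minus a
contracted product of `X Y'` with `Y X'`. -/
theorem contr_kulkarniNomizu (A B C D A' B' C' D' : ℝ) (k l : Fin n) :
    contr G x (fun c c' => contr G x fun d d' => contr G x fun e e' =>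
      ((A * G x k d + B * (u k * u d)) * (C * G x c e + D * (u c * u e))
        - (A * G x k e + B * (u k * u e)) * (C * G x c d + D * (u c * u d)))
      * ((A' * G x l d' + B' * (u l * u d')) * (C' * G x c' e' + D' * (u c' * u e'))
        - (A' * G x l e' + B' * (u l * u e')) * (C' * G x c' d' + D' * (u c' * u d'))))
    = 2 * ((A * A' * G x k l + (A * B' + B * A' - B * B') * (u k * u l))
        * (n * (C * C') - (C * D' + D * C' - D * D'))
      - ((A * C') * (C * A') * G x k l
        + ((A * C') * (C * B' + D * A' - D * B') + (A * D' + B * C' - B * D') * (C * A')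
          - (A * D' + B * C' - B * D') * (C * B' + D * A' - D * B')) * (u k * u l))) := by
  let X : Fin n → Fin n → ℝ := fun k d => A * G x k d + B * (u k * u d)
  let Y : Fin n → Fin n → ℝ := fun k d => C * G x k d + D * (u k * u d)
  let X' : Fin n → Fin n → ℝ := fun k d => A' * G x k d + B' * (u k * u d)
  let Y' : Fin n → Fin n → ℝ := fun k d => C' * G x k d + D' * (u k * u d)
  have hXX : ∀ k l, contr G x (fun a b => X k a * X' l b)
      = A * A' * G x k l + (A * B' + B * A' - B * B') * (u k * u l) :=
    fun k l => contr_perfectFluid_mul hG hx hu _ _ _ _ k l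
  have hYY : ∀ k l, contr G x (fun a b => Y k a * Y' l b)
      = C * C' * G x k l + (C * D' + D * C' - D * D') * (u k * u l) :=
    fun k l => contr_perfectFluid_mul hG hx hu _ _ _ _ k l
  have hXY : ∀ k l, contr G x (fun a b => X k a * Y' l b)
      = A * C' * G x k l + (A * D' + B * C' - B * D') * (u k * u l) :=
    fun k l => contr_perfectFluid_mul hG hx hu _ _ _ _ k l
  have hYX : ∀ k l, contr G x (fun a b => Y k a * X' l b)
      = C * A' * G x k l + (C * B' + D * A' - D * B') * (u k * u l) :=
    fun k l => contr_perfectFluid_mul hG hx hu _ _ _ _ k l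
  have hin : ∀ c c', (contr G x fun d d' => contr G x fun e e' =>
      (X k d * Y c e - X k e * Y c d) * (X' l d' * Y' c' e' - X' l e' * Y' c' d'))
      = 2 * (contr G x (fun a b => X k a * X' l b) * contr G x (fun a b => Y c a * Y' c' b)
        - contr G x (fun a b => X k a * Y' c' b) * contr G x (fun a b => Y c a * X' l b)) := by
    intro c c'
    have e1 : ∀ d d', (contr G x fun e e' =>
        (X k d * Y c e - X k e * Y c d) * (X' l d' * Y' c' e' - X' l e' * Y' c' d'))
        = contr G x (fun a b => Y c a * Y' c' b) * (X k d * X' l d')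
          - contr G x (fun a b => Y c a * X' l b) * (X k d * Y' c' d')
          - contr G x (fun a b => X k a * Y' c' b) * (Y c d * X' l d')
          + contr G x (fun a b => X k a * X' l b) * (Y c d * Y' c' d') := by
      intro d d'
      have : (fun e e' => (X k d * Y c e - X k e * Y c d) * (X' l d' * Y' c' e' - X' l e' * Y' c' d'))
          = fun e e' => (X k d * X' l d') * (Y c e * Y' c' e') - (X k d * Y' c' d') * (Y c e * X' l e')
            - (Y c d * X' l d') * (X k e * Y' c' e') + (Y c d * Y' c' d') * (X k e * X' l e') := by
        ext e e'; ring
      rw [this, contr_add, contr_sub, contr_sub, contr_mul_left, contr_mul_left, contr_mul_left,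
        contr_mul_left]
      ring
    simp only [e1]
    rw [contr_add, contr_sub, contr_sub, contr_mul_left, contr_mul_left, contr_mul_left,
      contr_mul_left]
    ring
  change contr G x (fun c c' => contr G x fun d d' => contr G x fun e e' =>
      (X k d * Y c e - X k e * Y c d) * (X' l d' * Y' c' e' - X' l e' * Y' c' d')) = _
  simp only [hin, hXX, hYY, hXY, hYX]
  have hlast : ∀ c c', (A * C' * G x k c' + (A * D' + B * C' - B * D') * (u k * u c'))
        * (C * A' * G x c l + (C * B' + D * A' - D * B') * (u c * u l))
      = (C * A' * G x l c + (C * B' + D * A' - D * B') * (u l * u c))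
        * (A * C' * G x k c' + (A * D' + B * C' - B * D') * (u k * u c')) := by
    intro c c'
    rw [hG.symm x hx l c]
    ring
  simp only [hlast]
  rw [contr_mul_left, contr_sub, contr_mul_left, contr_perfectFluid hG hx hu,
    contr_perfectFluid_mul hG hx hu, hG.symm x hx l k]
  ring

end Algebra

/-! ### Quadratic curvature tensors when Ricci and Riemann are built from `g` and `u`. -/

section Curvature

variable {n : ℕ} {G : MetricComp n} {Ω : Set (Coord n)} {x : Coord n} {u : Fin n → ℝ}
  {A B P Q : ℝ}

theorem ricRic_eq (hG : IsMetricOn G Ω) (hx : x ∈ Ω)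
    (hu : contr G x (fun a b => u a * u b) = -1)
    (hric : ∀ k l, ric G x k l = A * G x k l + B * (u k * u l)) (k l : Fin n) :
    ricRic G x k l = A ^ 2 * G x k l + (2 * A * B - B ^ 2) * (u k * u l) := by
  have := contr_perfectFluid_mul hG hx hu A B A B k l
  simp only [← hric] at this
  unfold ricRic
  rw [contr] at this
  rw [this]
  ring

theorem scal_eq (hG : IsMetricOn G Ω) (hx : x ∈ Ω)
    (hu : contr G x (fun a b => u a * u b) = -1)
    (hric : ∀ k l, ric G x k l = A * G x k l + B * (u k * u l)) :
    scal G x = n * A - B := by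
  have := contr_perfectFluid hG hx hu A B
  simp only [← hric] at this
  exact this

theorem ricSq_eq (hG : IsMetricOn G Ω) (hx : x ∈ Ω)
    (hu : contr G x (fun a b => u a * u b) = -1)
    (hric : ∀ k l, ric G x k l = A * G x k l + B * (u k * u l)) :
    ricSq G x = n * A ^ 2 - (2 * A * B - B ^ 2) := by
  rw [← contr_perfectFluid hG hx hu]
  simp only [← ricRic_eq hG hx hu hric]
  simp only [ricSq, ricUp, contr, ricRic, Finset.mul_sum]
  refine Finset.sum_congr rfl fun a _ => ?_
  rw [Finset.sum_comm]
  refine Finset.sum_congr rfl fun c _ => Finset.sum_congr rfl fun b _ =>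
    Finset.sum_congr rfl fun d _ => ?_
  ring

theorem ricUp_eq (hG : IsMetricOn G Ω) (hx : x ∈ Ω)
    (hric : ∀ k l, ric G x k l = A * G x k l + B * (u k * u l)) (a b : Fin n) :
    ricUp G x a b = A * gInv G x a b
      + B * ((∑ c, gInv G x a c * u c) * (∑ d, gInv G x b d * u d)) := by
  have e1 : ∀ c d, gInv G x a c * gInv G x b d * ric G x c d
      = A * (gInv G x a c * (gInv G x b d * G x d c))
        + B * ((gInv G x a c * u c) * (gInv G x b d * u d)) := by
    intro c d
    rw [hric, hG.symm x hx c d]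
    ring
  simp only [ricUp, e1, Finset.sum_add_distrib, ← Finset.mul_sum, hG.sum_gInv_mul hx,
    ← Finset.sum_mul]
  simp

/-- As `Rᵃᵇ = A gᵃᵇ + B uᵃ uᵇ`, the contraction is `A R_{kl} + B R_{akbl} uᵃ uᵇ`, and the last
factor is `-(P - Q) (g_{kl} + u_k u_l)`. -/
theorem riemRic_eq (hG : IsMetricOn G Ω) (hx : x ∈ Ω)
    (hu : contr G x (fun a b => u a * u b) = -1)
    (hric : ∀ k l, ric G x k l = A * G x k l + B * (u k * u l))
    (hriem : ∀ a b c d, riem G x a b c d = P * (G x a c * G x b d - G x a d * G x b c)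
      + Q * (G x a c * (u b * u d) - G x a d * (u b * u c) - G x b c * (u a * u d)
        + G x b d * (u a * u c))) (k l : Fin n) :
    riemRic G x k l = (A ^ 2 - B * (P - Q)) * G x k l + (A * B - B * (P - Q)) * (u k * u l) := by
  have e1 : riemRic G x k l = A * ric G x k l
      + B * contr G x fun a c => contr G x fun b d => riem G x a k b l * (u c * u d) := by
    simp only [riemRic, ricUp_eq hG hx hric, ric, contr, mul_add, Finset.sum_add_distrib,
      Finset.mul_sum, Finset.sum_mul]
    congr 1
    · exact Finset.sum_congr rfl fun a _ => Finset.sum_congr rfl fun b _ => by ring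
    · refine Finset.sum_congr rfl fun a _ => ?_
      rw [Finset.sum_comm]
      refine (Finset.sum_congr rfl fun _ _ => Finset.sum_comm).trans (Finset.sum_comm.trans ?_)
      refine (Finset.sum_congr rfl fun _ _ => Finset.sum_comm).trans ?_
      exact Finset.sum_congr rfl fun b _ => Finset.sum_congr rfl fun c _ =>
        Finset.sum_congr rfl fun d _ => by ring
  have e2 : ∀ a c, (contr G x fun b d => riem G x a k b l * (u c * u d))
      = (P - Q) * (u a * u c * G x k l - G x a l * u c * u k) := by
    intro a c
    have : (fun b d => riem G x a k b l * (u c * u d)) = fun b d =>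
        (u c * (P * G x k l + Q * (u k * u l))) * (G x a b * u d)
        + (-(u c * (P * G x a l + Q * (u a * u l)))) * (G x k b * u d)
        + (u c * Q * (G x k l * u a - G x a l * u k)) * (u b * u d) := by
      ext b d
      rw [hriem]
      ring
    rw [this, contr_add, contr_add, contr_mul_left, contr_mul_left, contr_mul_left,
      hG.contr_metric_mul hx, hG.contr_metric_mul hx, hu]
    ring
  have e3 : (fun a c => (P - Q) * (u a * u c * G x k l - G x a l * u c * u k)) = fun a c =>
      ((P - Q) * G x k l) * (u a * u c) - ((P - Q) * u k) * (G x l a * u c) := by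
    ext a c
    rw [hG.symm x hx a l]
    ring
  simp only [e1, e2]
  rw [e3, contr_sub, contr_mul_left, contr_mul_left, hG.contr_metric_mul hx, hu, hric]
  ring

theorem riemRiem_eq (hG : IsMetricOn G Ω) (hx : x ∈ Ω)
    (hu : contr G x (fun a b => u a * u b) = -1)
    (hriem : ∀ a b c d, riem G x a b c d = P * (G x a c * G x b d - G x a d * G x b c)
      + Q * (G x a c * (u b * u d) - G x a d * (u b * u c) - G x b c * (u a * u d)
        + G x b d * (u a * u c))) (k l : Fin n) :
    riemRiem G x k l = (2 * (P - Q) ^ 2 + 2 * (n - 2) * P ^ 2) * G x k l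
      + (2 * (P - Q) ^ 2 + 2 * (n - 2) * P ^ 2 - 2 * (n - 1) * (P - Q) ^ 2) * (u k * u l) := by
  have e1 : riemRiem G x k l = contr G x fun c c' => contr G x fun d d' => contr G x fun e e' =>
      riem G x k c d e * riem G x l c' d' e' := by
    simp only [riemRiem, contr, Finset.mul_sum]
    refine Finset.sum_congr rfl fun c _ => ?_
    refine (Finset.sum_congr rfl fun _ _ => Finset.sum_comm).trans (Finset.sum_comm.trans ?_)
    refine Finset.sum_congr rfl fun c' _ => Finset.sum_congr rfl fun d _ => ?_
    rw [Finset.sum_comm]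
    exact Finset.sum_congr rfl fun d' _ => Finset.sum_congr rfl fun e _ =>
      Finset.sum_congr rfl fun e' _ => by ring
  -- The curvature is the sum of two tensors of the shape handled by `contr_kulkarniNomizu`: one
  -- pairs `g` with `P g + Q u u`, the other pairs `Q u u` with `g`. The square then has four terms
  -- of that type.
  let K : ℝ → ℝ → ℝ → ℝ → Fin n → Fin n → Fin n → Fin n → ℝ := fun A B C D k c d e =>
    (A * G x k d + B * (u k * u d)) * (C * G x c e + D * (u c * u e))
        - (A * G x k e + B * (u k * u e)) * (C * G x c d + D * (u c * u d))
  have e2 : ∀ k c d e, riem G x k c d e = K 1 0 P Q k c d e + K 0 Q 1 0 k c d e := by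
    intro k c d e
    rw [hriem]
    simp only [K]
    ring
  have e3 : ∀ c c' d d' e e', riem G x k c d e * riem G x l c' d' e'
      = K 1 0 P Q k c d e * K 1 0 P Q l c' d' e' + K 1 0 P Q k c d e * K 0 Q 1 0 l c' d' e'
        + K 0 Q 1 0 k c d e * K 1 0 P Q l c' d' e' + K 0 Q 1 0 k c d e * K 0 Q 1 0 l c' d' e' := by
    intros
    rw [e2, e2]
    ring
  rw [e1]
  simp only [e3, contr_add]
  simp only [K]
  rw [contr_kulkarniNomizu hG hx hu, contr_kulkarniNomizu hG hx hu, contr_kulkarniNomizu hG hx hu,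
    contr_kulkarniNomizu hG hx hu]
  ring

theorem riemSq_eq (hG : IsMetricOn G Ω) (hx : x ∈ Ω)
    (hu : contr G x (fun a b => u a * u b) = -1)
    (hriem : ∀ a b c d, riem G x a b c d = P * (G x a c * G x b d - G x a d * G x b c)
      + Q * (G x a c * (u b * u d) - G x a d * (u b * u c) - G x b c * (u a * u d)
        + G x b d * (u a * u c))) :
    riemSq G x = n * (2 * (P - Q) ^ 2 + 2 * (n - 2) * P ^ 2)
      - (2 * (P - Q) ^ 2 + 2 * (n - 2) * P ^ 2 - 2 * (n - 1) * (P - Q) ^ 2) := by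
  have := contr_perfectFluid hG hx hu (2 * (P - Q) ^ 2 + 2 * (n - 2) * P ^ 2)
    (2 * (P - Q) ^ 2 + 2 * (n - 2) * P ^ 2 - 2 * (n - 1) * (P - Q) ^ 2)
  simp only [← riemRiem_eq hG hx hu hriem] at this
  exact this

end Curvature

/-! ### Differential calculus of a unit torse-forming covector. -/

/-- The gradient of the scalar `f` is `f₁ u` on `Ω`. -/
structure IsGradAlong {n : ℕ} (u : Coord n → Fin n → ℝ) (Ω : Set (Coord n))
    (f f₁ : Coord n → ℝ) : Prop where
  smooth : ContDiffOn ℝ ∞ f Ω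
  pd_eq : ∀ x ∈ Ω, ∀ k, pd k f x = f₁ x * u x k

/-- A unit timelike covector field `u` with `∇ₐ u_k = φ (g_{ak} + uₐ u_k)`. -/
structure IsTorseForming {n : ℕ} (G : MetricComp n) (u : Coord n → Fin n → ℝ) (φ : Coord n → ℝ)
    (Ω : Set (Coord n)) : Prop where
  metric : IsMetricOn G Ω
  smooth : ∀ k, ContDiffOn ℝ ∞ (fun y => u y k) Ω
  smooth_coeff : ContDiffOn ℝ ∞ φ Ω
  unit : ∀ x ∈ Ω, contr G x (fun a b => u x a * u x b) = -1
  cov1_eq : ∀ x ∈ Ω, ∀ a k, cov1 G u x a k = φ x * (G x a k + u x a * u x k)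

namespace IsTorseForming

variable {n : ℕ} {G : MetricComp n} {u : Coord n → Fin n → ℝ} {φ : Coord n → ℝ}
  {Ω : Set (Coord n)} (h : IsTorseForming G u φ Ω) {x : Coord n}
include h

theorem differentiableAt (hx : x ∈ Ω) (k : Fin n) : DifferentiableAt ℝ (fun y => u y k) x :=
  (h.smooth k).differentiableAt_of_isOpen h.metric.isOpen hx

theorem differentiableAt_metric (hx : x ∈ Ω) (k l : Fin n) :
    DifferentiableAt ℝ (fun y => G y k l) x :=
  (h.metric.smooth k l).differentiableAt_of_isOpen h.metric.isOpen hx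

theorem cov2_sq (hx : x ∈ Ω) (a k l : Fin n) :
    cov2 G (fun y k l => u y k * u y l) x a k l
      = φ x * ((G x a k + u x a * u x k) * u x l + u x k * (G x a l + u x a * u x l)) := by
  rw [cov2_tmul (h.differentiableAt hx) (h.differentiableAt hx), h.cov1_eq x hx, h.cov1_eq x hx]
  ring

theorem cov2_perfectFluid {A B : Coord n → ℝ} (hA : ContDiffOn ℝ ∞ A Ω)
    (hB : ContDiffOn ℝ ∞ B Ω) (hx : x ∈ Ω) (a k l : Fin n) :
    cov2 G (fun y k l => A y * G y k l + B y * (u y k * u y l)) x a k l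
      = pd a A x * G x k l + pd a B x * (u x k * u x l)
        + B x * φ x * ((G x a k + u x a * u x k) * u x l
          + u x k * (G x a l + u x a * u x l)) := by
  have hAd := hA.differentiableAt_of_isOpen h.metric.isOpen hx
  have hBd := hB.differentiableAt_of_isOpen h.metric.isOpen hx
  have hu := h.differentiableAt hx
  have hg := h.differentiableAt_metric hx
  rw [cov2_add (fun k l => hAd.fun_mul (hg k l)) (fun k l => hBd.fun_mul ((hu k).fun_mul (hu l))),
    cov2_smul hAd hg, cov2_smul hBd (fun k l => (hu k).fun_mul (hu l)), h.cov2_sq hx,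
    h.metric.cov2_metric hx]
  ring

theorem hess_eq {f f₁ f₂ : Coord n → ℝ} (hf : IsGradAlong u Ω f f₁) (hf₁ : IsGradAlong u Ω f₁ f₂)
    (hx : x ∈ Ω) (k l : Fin n) :
    hess G f x k l = f₁ x * φ x * G x k l + (f₂ x + f₁ x * φ x) * (u x k * u x l) := by
  unfold hess
  rw [cov1_congr h.metric.isOpen hx (w := fun y j => f₁ y * u y j)
      (fun y hy => funext fun j => hf.pd_eq y hy j),
    cov1_smul (hf₁.smooth.differentiableAt_of_isOpen h.metric.isOpen hx) (h.differentiableAt hx),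
    h.cov1_eq x hx, hf₁.pd_eq x hx]
  ring

theorem box0_eq {f f₁ f₂ : Coord n → ℝ} (hf : IsGradAlong u Ω f f₁) (hf₁ : IsGradAlong u Ω f₁ f₂)
    (hx : x ∈ Ω) : box0 G f x = n * (f₁ x * φ x) - (f₂ x + f₁ x * φ x) := by
  have := contr_perfectFluid h.metric hx (h.unit x hx) (f₁ x * φ x) (f₂ x + f₁ x * φ x)
  simp only [← h.hess_eq hf hf₁ hx] at this
  exact this

/-- The first derivative is `∇_b S_{kl} = u_b (A₁ g_{kl} + E u_k u_l) + C (g_{bk} u_l + g_{bl}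
u_k)`, with `C = B φ` and `E = B₁ + 2 C`. In the contracted second derivative, the derivative of `C`
enters with `-2` through `E` and with `+2` through the `C` terms, so `φ₁` drops out. -/
theorem box2_perfectFluid {A A₁ A₂ B B₁ B₂ φ₁ : Coord n → ℝ} (hφ : IsGradAlong u Ω φ φ₁)
    (hA : IsGradAlong u Ω A A₁) (hA₁ : IsGradAlong u Ω A₁ A₂)
    (hB : IsGradAlong u Ω B B₁) (hB₁ : IsGradAlong u Ω B₁ B₂)
    {S : Coord n → Fin n → Fin n → ℝ}
    (hS : ∀ y ∈ Ω, ∀ k l, S y k l = A y * G y k l + B y * (u y k * u y l))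
    (hx : x ∈ Ω) (k l : Fin n) :
    box2 G S x k l = (-A₂ x + (n - 1) * φ x * A₁ x + 2 * B x * φ x ^ 2) * G x k l
      + (-B₂ x + (n - 1) * φ x * B₁ x + 2 * n * B x * φ x ^ 2) * (u x k * u x l) := by
  have hΩ := h.metric.isOpen
  have hu := h.differentiableAt hx
  have hg := h.differentiableAt_metric hx
  have hφd := hφ.smooth.differentiableAt_of_isOpen hΩ hx
  have hA₁d := hA₁.smooth.differentiableAt_of_isOpen hΩ hx
  have hBd := hB.smooth.differentiableAt_of_isOpen hΩ hx
  have hB₁d := hB₁.smooth.differentiableAt_of_isOpen hΩ hx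
  have huu : ∀ k l, DifferentiableAt ℝ (fun y => u y k * u y l) x :=
    fun k l => (hu k).fun_mul (hu l)
  let C : Coord n → ℝ := fun y => B y * φ y
  let E : Coord n → ℝ := fun y => B₁ y + 2 * C y
  have hCd : DifferentiableAt ℝ C x := hBd.fun_mul hφd
  have hEd : DifferentiableAt ℝ E x := hB₁d.fun_add (hCd.const_mul 2)
  have hpC : ∀ a, pd a C x = (B₁ x * φ x + B x * φ₁ x) * u x a := by
    intro a
    rw [pd_mul hBd hφd, hB.pd_eq x hx, hφ.pd_eq x hx]
    ring
  have hpE : ∀ a, pd a E x = (B₂ x + 2 * (B₁ x * φ x + B x * φ₁ x)) * u x a := by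
    intro a
    rw [pd_add hB₁d (hCd.const_mul 2), pd_const_mul hCd, hB₁.pd_eq x hx, hpC]
    ring
  have hcov : ∀ y ∈ Ω, cov2 G S y = fun b k l =>
      u y b * (A₁ y * G y k l + E y * (u y k * u y l))
        + (C y * (G y b k * u y l) + C y * (G y b l * u y k)) := by
    intro y hy
    funext b k l
    rw [cov2_congr hΩ hy (fun z hz => funext fun k => funext fun l => hS z hz k l),
      h.cov2_perfectFluid hA.smooth hB.smooth hy, hA.pd_eq y hy, hB.pd_eq y hy]
    simp only [E, C]
    ring
  have hAE : ∀ k l, DifferentiableAt ℝ (fun y => A₁ y * G y k l + E y * (u y k * u y l)) x :=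
    fun k l => (hA₁d.fun_mul (hg k l)).fun_add (hEd.fun_mul (huu k l))
  have hgu : ∀ b k l, DifferentiableAt ℝ (fun y => G y b k * u y l) x :=
    fun b k l => (hg b k).fun_mul (hu l)
  have hcov3 : ∀ a b, cov3 G (cov2 G S) x a b k l
      = φ x * (G x a b + u x a * u x b) * (A₁ x * G x k l + E x * (u x k * u x l))
        + u x b * (A₂ x * u x a * G x k l
          + (B₂ x + 2 * (B₁ x * φ x + B x * φ₁ x)) * u x a * (u x k * u x l)
          + E x * (φ x * ((G x a k + u x a * u x k) * u x l
            + u x k * (G x a l + u x a * u x l))))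
        + ((B₁ x * φ x + B x * φ₁ x) * u x a * (G x b k * u x l)
          + C x * (G x b k * (φ x * (G x a l + u x a * u x l)))
          + ((B₁ x * φ x + B x * φ₁ x) * u x a * (G x b l * u x k)
          + C x * (G x b l * (φ x * (G x a k + u x a * u x k))))) := by
    intro a b
    rw [cov3_congr hΩ hx hcov,
      cov3_add (fun b k l => (hu b).fun_mul (hAE k l))
        (fun b k l => (hCd.fun_mul (hgu b k l)).fun_add (hCd.fun_mul (hgu b l k))),
      cov3_tmul hu hAE,
      cov3_add (fun b k l => hCd.fun_mul (hgu b k l)) (fun b k l => hCd.fun_mul (hgu b l k)),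
      cov3_smul hCd hgu, cov3_smul hCd (fun b k l => hgu b l k),
      cov3_swap (S := fun y b k l => G y b k * u y l) a b k l,
      cov3_tmul' (S := fun y b k => G y b k) hu hg, cov3_tmul' (S := fun y b k => G y b k) hu hg,
      cov2_add (fun k l => hA₁d.fun_mul (hg k l)) (fun k l => hEd.fun_mul (huu k l)),
      cov2_smul hA₁d hg, cov2_smul hEd huu, h.cov2_sq hx, h.metric.cov2_metric hx,
      h.metric.cov2_metric hx, h.metric.cov2_metric hx, hpC, hpE, h.cov1_eq x hx, h.cov1_eq x hx,
      h.cov1_eq x hx, hA₁.pd_eq x hx]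
    ring
  have hgs := h.metric.symm x hx
  -- Every summand is arranged so that a single contraction rule applies; the last one is
  -- antisymmetric in `k`, `l` and contracts to zero.
  have hfin : (fun a b => cov3 G (cov2 G S) x a b k l) = fun a b =>
      φ x * (A₁ x * G x k l + E x * (u x k * u x l)) * G x a b
      + (φ x * (A₁ x * G x k l + E x * (u x k * u x l)) + A₂ x * G x k l
          + (B₂ x + 2 * (B₁ x * φ x + B x * φ₁ x) + 2 * E x * φ x) * (u x k * u x l))
          * (u x a * u x b)
      + (E x * φ x * u x l) * (G x k a * u x b) + (E x * φ x * u x k) * (G x l a * u x b)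
      + ((B₁ x * φ x + B x * φ₁ x) * u x l + C x * φ x * u x l) * (G x k b * u x a)
      + ((B₁ x * φ x + B x * φ₁ x) * u x k + C x * φ x * u x k) * (G x l b * u x a)
      + 2 * C x * φ x * (G x l a * G x k b)
      + C x * φ x * (G x k a * G x l b - G x l a * G x k b) := by
    funext a b
    rw [hcov3, hgs k a, hgs l a, hgs k b, hgs l b]
    ring
  have hm := h.metric
  have e1 : ∀ k l, contr G x (fun a b => G x k a * G x l b) = G x k l := fun k l => by
    rw [hm.contr_metric_mul hx k (fun b => G x l b), hgs]
  change contr G x (fun a b => cov3 G (cov2 G S) x a b k l) = _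
  rw [hfin]
  simp only [contr_add]
  rw [contr_mul_left _ (fun a b => G x a b)]
  simp only [contr_mul_left, contr_sub]
  rw [hm.contr_metric hx, h.unit x hx, hm.contr_metric_mul hx, hm.contr_metric_mul hx,
    hm.contr_symm hx (fun a b => G x k a * u x b), hm.contr_symm hx (fun a b => G x l a * u x b),
    hm.contr_metric_mul hx, hm.contr_metric_mul hx, e1, e1, hgs l k]
  simp only [E, C]
  ring

/-- The Ricci identity for `u`: differentiating the torse-forming equation once more and
antisymmetrizing leaves only `φ² - φ₁`. -/
theorem sum_riemUp_mul {φ₁ : Coord n → ℝ} (hφ : IsGradAlong u Ω φ φ₁) (hx : x ∈ Ω)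
    (a b c : Fin n) :
    ∑ m, riemUp G x a b c m * u x m
      = (φ x ^ 2 - φ₁ x) * (u x b * G x a c - u x a * G x b c) := by
  rw [← h.metric.cov2_cov1_sub h.smooth hx]
  have hc : ∀ a b c, cov2 G (cov1 G u) x a b c = φ₁ x * u x a * (G x b c + u x b * u x c)
      + φ x * φ x * ((G x a b + u x a * u x b) * u x c + u x b * (G x a c + u x a * u x c)) := by
    intro a b c
    rw [cov2_congr h.metric.isOpen hx
      (T := fun y k l => φ y * G y k l + φ y * (u y k * u y l))
      (fun y hy => funext fun k => funext fun l => by rw [h.cov1_eq y hy]; ring),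
      h.cov2_perfectFluid h.smooth_coeff h.smooth_coeff hx, hφ.pd_eq x hx]
    ring
  rw [hc, hc, h.metric.symm x hx b a]
  ring

end IsTorseForming

/-- The curvature of a conformally flat metric whose Ricci tensor is a perfect fluid. -/
theorem riem_of_weyl_eq_zero {n : ℕ} {G : MetricComp n} {x : Coord n} {u : Fin n → ℝ} {A B : ℝ}
    (hW : ∀ i j k l, weyl G x i j k l = 0)
    (hric : ∀ k l, ric G x k l = A * G x k l + B * (u k * u l)) (a b c d : Fin n) :
    riem G x a b c d
      = (2 * A / (n - 2) - scal G x / ((n - 1) * (n - 2))) * (G x a c * G x b d - G x a d * G x b c)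
      + B / (n - 2) * (G x a c * (u b * u d) - G x a d * (u b * u c) - G x b c * (u a * u d)
        + G x b d * (u a * u c)) := by
  have := hW a b c d
  unfold weyl at this
  rw [hric, hric, hric, hric] at this
  linear_combination this

/-! ### Comoving coordinates: the Ricci tensor and spatial constancy of the scalar curvature. -/

/-- The components `-δ_{k0}` of the velocity covector in comoving coordinates. -/
def comovingU {d : ℕ} (_ : Coord (d + 1)) (k : Fin (d + 1)) : ℝ := if k = 0 then -1 else 0

/-- The metric in comoving coordinates: `-dt²` plus a spatial part that is multiplied by a function
of time, where `φ` is the expansion rate. -/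
structure IsComovingMetric {d : ℕ} (G : MetricComp (d + 1)) (φ : Coord (d + 1) → ℝ)
    (Ω : Set (Coord (d + 1))) : Prop where
  metric : IsMetricOn G Ω
  zero_left : ∀ x ∈ Ω, ∀ k, G x 0 k = comovingU x k
  pd_zero : ∀ x ∈ Ω, ∀ i j, pd 0 (fun y => G y i j) x
    = 2 * φ x * (G x i j + comovingU x i * comovingU x j)
  smooth_rate : ContDiffOn ℝ ∞ φ Ω
  pd_rate : ∀ x ∈ Ω, ∀ μ : Fin d, pd μ.succ φ x = 0

/-- The sign reflects `u_0 = -1`: lowering the index of `∂_t` reverses it. -/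
theorem isGradAlong_comovingU {d : ℕ} {Ω : Set (Coord (d + 1))} {f : Coord (d + 1) → ℝ}
    (hf : ContDiffOn ℝ ∞ f Ω) (h : ∀ x ∈ Ω, ∀ μ : Fin d, pd μ.succ f x = 0) :
    IsGradAlong comovingU Ω f (fun y => -pd 0 f y) := by
  refine ⟨hf, fun x hx k => ?_⟩
  refine Fin.cases ?_ (fun μ => ?_) k
  · simp [comovingU]
  · simp [comovingU, h x hx μ]

theorem pd_succ_pd_zero {d : ℕ} {Ω : Set (Coord (d + 1))} {f : Coord (d + 1) → ℝ}
    (hΩ : IsOpen Ω) (hf : ContDiffOn ℝ ∞ f Ω) (h : ∀ x ∈ Ω, ∀ μ : Fin d, pd μ.succ f x = 0)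
    {x : Coord (d + 1)} (hx : x ∈ Ω) (μ : Fin d) : pd μ.succ (pd 0 f) x = 0 := by
  rw [pd_comm hΩ hx hf, pd_congr hΩ hx (fun y hy => h y hy μ), pd_const]

namespace IsComovingMetric

variable {d : ℕ} {G : MetricComp (d + 1)} {φ : Coord (d + 1) → ℝ}
  {Ω : Set (Coord (d + 1))} (h : IsComovingMetric G φ Ω) {x : Coord (d + 1)}
include h

theorem zero_right (hx : x ∈ Ω) (k : Fin (d + 1)) : G x k 0 = comovingU x k := by
  rw [h.metric.symm x hx, h.zero_left x hx]

/-- Since `u_k = g_{0k}` is constant, `∇ₐ u_k` is minus the Christoffel symbol with lowered index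
`0`, that is `½ ∂_t g_{ak}`, and `pd_zero` evaluates this. -/
theorem isTorseForming : IsTorseForming G comovingU φ Ω := by
  refine ⟨h.metric, fun k => contDiffOn_const, h.smooth_rate, fun x hx => ?_, fun x hx a k => ?_⟩
  · have := h.metric.contr_metric_mul hx 0 (comovingU x)
    simp only [h.zero_left x hx] at this
    rw [this]
    simp [comovingU]
  · have e : ∑ m, christoffel G x m a k * comovingU x m = christoffelLow G x a k 0 := by
      rw [← h.metric.sum_christoffel_mul hx]
      exact Finset.sum_congr rfl fun m _ => by rw [h.zero_right hx]
    have e1 : pd a (fun y => comovingU y k) x = 0 := pd_const a _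
    have e2 : pd a (fun y => G y 0 k) x = 0 := by
      rw [pd_congr h.metric.isOpen hx (fun y hy => h.zero_left y hy k)]
      exact pd_const a _
    have e3 : pd k (fun y => G y a 0) x = 0 := by
      rw [pd_congr h.metric.isOpen hx (fun y hy => h.zero_right hy a)]
      exact pd_const k _
    unfold cov1
    rw [e, christoffelLow, e1, e2, e3, h.pd_zero x hx]
    ring

theorem isGradAlong_rate : IsGradAlong comovingU Ω φ (fun y => -pd 0 φ y) :=
  isGradAlong_comovingU h.smooth_rate h.pd_rate

theorem riem_zero_right (hx : x ∈ Ω) (a b c : Fin (d + 1)) :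
    riem G x a b c 0
      = (φ x ^ 2 + pd 0 φ x) * (comovingU x b * G x a c - comovingU x a * G x b c) := by
  have := h.isTorseForming.sum_riemUp_mul h.isGradAlong_rate hx a b c
  rw [sub_neg_eq_add] at this
  rw [← this]
  exact Finset.sum_congr rfl fun m _ => by rw [h.zero_right hx]

theorem ric_zero_right (hx : x ∈ Ω) (b : Fin (d + 1)) :
    ric G x b 0 = d * (φ x ^ 2 + pd 0 φ x) * comovingU x b := by
  change contr G x (fun a c => riem G x a b c 0) = _
  simp only [h.riem_zero_right hx]
  rw [contr_mul_left, contr_sub, contr_mul_left _ (fun a c => G x a c), h.metric.contr_metric hx]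
  have : (fun a c => comovingU x a * G x b c) = fun a c => G x b c * comovingU x a := by
    funext a c; ring
  rw [this, h.metric.contr_symm hx (fun a c => G x b a * comovingU x c),
    h.metric.contr_metric_mul hx]
  push_cast
  ring

/-- The Ricci tensor of a conformally flat metric in comoving coordinates. -/
theorem ric_eq (hd : 2 ≤ d) (hx : x ∈ Ω) (hW : ∀ i j k l, weyl G x i j k l = 0)
    (a c : Fin (d + 1)) :
    ric G x a c = (scal G x / d - (φ x ^ 2 + pd 0 φ x)) * G x a c
      + (scal G x / d - (d + 1) * (φ x ^ 2 + pd 0 φ x)) * (comovingU x a * comovingU x c) := by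
  -- In `C_{a0c0}` the Riemann component and all `R_{·0}` are known from the Ricci identity for `u`.
  -- The equation is linear in `R_{ac}` with coefficient a nonzero multiple of `g_{00} = -1`, so it
  -- can be solved.
  have hw := hW a 0 c 0
  have hd2 : (2 : ℝ) ≤ d := by exact_mod_cast hd
  have h1 : (d : ℝ) - 1 ≠ 0 := by linarith
  have h2 : (d : ℝ) ≠ 0 := by linarith
  have h0 : comovingU x 0 = -1 := by simp [comovingU]
  unfold weyl at hw
  rw [h.riem_zero_right hx, h.metric.ric_symm hx 0 c, h.ric_zero_right hx, h.ric_zero_right hx,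
    h.ric_zero_right hx, h.zero_right hx, h.zero_right hx, h.zero_left x hx, h0] at hw
  push_cast at hw
  rw [show (d : ℝ) + 1 - 2 = d - 1 by ring, show (d : ℝ) + 1 - 1 = d by ring] at hw
  field_simp at hw ⊢
  linear_combination hw

theorem pd_succ_sq_add (hx : x ∈ Ω) (μ : Fin d) : pd μ.succ (fun y => φ y ^ 2 + pd 0 φ y) x = 0 := by
  have hφ := h.smooth_rate.differentiableAt_of_isOpen h.metric.isOpen hx
  have hp := (contDiffOn_pd h.metric.isOpen h.smooth_rate 0).differentiableAt_of_isOpen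
    h.metric.isOpen hx
  rw [pd_add (f := fun y => φ y ^ 2) (g := pd 0 φ) (hφ.pow 2) hp,
    pd_succ_pd_zero h.metric.isOpen h.smooth_rate h.pd_rate hx]
  simp only [pow_two]
  rw [pd_mul hφ hφ, h.pd_rate x hx]
  ring

theorem smooth_sq_add : ContDiffOn ℝ ∞ (fun y => φ y ^ 2 + pd 0 φ y) Ω :=
  (h.smooth_rate.pow 2).add (contDiffOn_pd h.metric.isOpen h.smooth_rate 0)

theorem differentiableAt_scal (hx : x ∈ Ω) : DifferentiableAt ℝ (fun y => scal G y) x :=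
  h.metric.smooth_scal.differentiableAt_of_isOpen h.metric.isOpen hx

/-- The Ricci coefficients and the coefficient `P` of the Riemann tensor all have this shape, and
`φ² + ∂_t φ` depends on time only. -/
theorem pd_succ_scal_combination (hx : x ∈ Ω) (r s : ℝ) (μ : Fin d) :
    pd μ.succ (fun y => r * scal G y - s * (φ y ^ 2 + pd 0 φ y)) x = r * pd μ.succ (scal G) x := by
  have hξ := h.smooth_sq_add.differentiableAt_of_isOpen h.metric.isOpen hx
  have hs := h.differentiableAt_scal hx
  rw [pd_sub (hs.const_mul r) (hξ.const_mul s), pd_const_mul hs, pd_const_mul hξ,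
    h.pd_succ_sq_add hx]
  simp

/-- The scalar curvature is spatially constant if the Cotton tensor vanishes. -/
theorem pd_scal_of_cotton (hd : 2 ≤ d) (hx : x ∈ Ω)
    (hW : ∀ x ∈ Ω, ∀ i j k l, weyl G x i j k l = 0) (hC : ∀ j k l, cotton G x j k l = 0)
    (μ : Fin d) : pd μ.succ (scal G) x = 0 := by
  have hd2 : (2 : ℝ) ≤ d := by exact_mod_cast hd
  have hcoef : ∀ r s : ℝ, ContDiffOn ℝ ∞ (fun y => r * scal G y - s * (φ y ^ 2 + pd 0 φ y)) Ω :=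
    fun r s => (contDiffOn_const.mul h.metric.smooth_scal).sub
      (contDiffOn_const.mul h.smooth_sq_add)
  have hcov : ∀ a k l, cov2 G (ric G) x a k l = _ := fun a k l => by
    rw [cov2_congr h.metric.isOpen hx (fun y hy => funext fun k => funext fun l =>
      show ric G y k l = ((d : ℝ)⁻¹ * scal G y - 1 * (φ y ^ 2 + pd 0 φ y)) * G y k l
        + ((d : ℝ)⁻¹ * scal G y - (d + 1) * (φ y ^ 2 + pd 0 φ y))
          * (comovingU y k * comovingU y l) by
      rw [h.ric_eq hd hy (hW y hy)]; ring),
      h.isTorseForming.cov2_perfectFluid (hcoef _ _) (hcoef _ _) hx]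
  -- In this component `R / d` enters through the coefficients of `g` and of `u ⊗ u`, and the two
  -- cancel because `g_{00} = -1` and `u_0² = 1`. Only the explicit term `-∂_μ R / (2 d)` of the
  -- Cotton tensor survives.
  have hc := hC μ.succ 0 0
  have h0 : comovingU x 0 = -1 := by simp [comovingU]
  have h1 : comovingU x μ.succ = 0 := by simp [comovingU]
  unfold cotton at hc
  rw [hcov, hcov, h.pd_succ_scal_combination hx, h.pd_succ_scal_combination hx, h.zero_right hx,
    h.zero_right hx, h.zero_left x hx, h0, h1] at hc
  push_cast at hc
  have hd0 : (d : ℝ) ≠ 0 := by linarith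
  have : (d : ℝ) + 1 - 1 = d := by ring
  rw [this] at hc
  field_simp at hc
  linarith

/-- The scalar curvature of a conformally flat metric is spatially constant in dimension at least
four. -/
theorem pd_scal_of_three_le (hd : 3 ≤ d) (hx : x ∈ Ω)
    (hW : ∀ x ∈ Ω, ∀ i j k l, weyl G x i j k l = 0) (μ : Fin d) :
    pd μ.succ (scal G) x = 0 := by
  have hd3 : (3 : ℝ) ≤ d := by exact_mod_cast hd
  have hd0 : (d : ℝ) ≠ 0 := by linarith
  have hd1 : (d : ℝ) - 1 ≠ 0 := by linarith
  -- Two further distinct spatial directions are needed, and they exist because `3 ≤ d`.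
  obtain ⟨ν, hν⟩ : ∃ ν : Fin d, ν ∉ ({μ} : Finset (Fin d)) := by
    by_contra! hcon
    have := Finset.card_le_card (fun i _ => hcon i : (Finset.univ : Finset (Fin d)) ⊆ {μ})
    simp at this; omega
  obtain ⟨ρ, hρ⟩ : ∃ ρ : Fin d, ρ ∉ ({μ, ν} : Finset (Fin d)) := by
    by_contra! hcon
    have := Finset.card_le_card (fun i _ => hcon i : (Finset.univ : Finset (Fin d)) ⊆ {μ, ν})
    have h2 := Finset.card_le_two (a := μ) (b := ν)
    simp at this; omega
  simp only [Finset.mem_singleton, Finset.mem_insert, not_or] at hν hρ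
  let P : Coord (d + 1) → ℝ := fun y => ((d : ℝ) * (d - 1))⁻¹ * scal G y
    - 2 / (d - 1) * (φ y ^ 2 + pd 0 φ y)
  have hPs : ContDiffOn ℝ ∞ P Ω :=
    (contDiffOn_const.mul h.metric.smooth_scal).sub (contDiffOn_const.mul h.smooth_sq_add)
  have hPd := hPs.differentiableAt_of_isOpen h.metric.isOpen hx
  have hP : ∀ σ : Fin d, pd σ.succ P x = ((d : ℝ) * (d - 1))⁻¹ * pd σ.succ (scal G) x :=
    fun σ => h.pd_succ_scal_combination hx _ _ σ
  -- Each `u ⊗ u` term of the Riemann tensor carries an index of the first pair, so it vanishes when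
  -- both of these are spatial. The function `P` is the remaining coefficient, with the Ricci
  -- coefficient substituted.
  have hriem : ∀ y ∈ Ω, ∀ (b c : Fin d), riem G y b.succ c.succ = fun k f =>
      P y * (G y b.succ k * G y c.succ f + (-1 : ℝ) * (G y c.succ k * G y b.succ f)) := by
    intro y hy b c
    funext k f
    have h1 : ∀ σ : Fin d, comovingU y σ.succ = 0 := by simp [comovingU]
    rw [riem_of_weyl_eq_zero (hW y hy) (h.ric_eq (by omega) hy (hW y hy)) b.succ c.succ,
      h1, h1]
    push_cast
    rw [show (d : ℝ) + 1 - 2 = d - 1 by ring, show (d : ℝ) + 1 - 1 = d by ring]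
    simp only [P]
    field_simp
    ring
  have hg : ∀ i j, DifferentiableAt ℝ (fun y => G y i j) x := h.isTorseForming.differentiableAt_metric hx
  -- With `b` as a mere label, row `b` of the metric is a covector field that need not be parallel.
  have hrow : ∀ a b k, cov1 G (fun y => G y b) x a k = christoffelLow G x a b k := by
    intro a b k
    unfold cov1
    rw [h.metric.pd_metric hx]
    have : ∑ m, christoffel G x m a k * G x b m = christoffelLow G x a k b := by
      rw [← h.metric.sum_christoffel_mul hx]
      exact Finset.sum_congr rfl fun m _ => by rw [h.metric.symm x hx b m]
    rw [this]
    ring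
  have hgg : ∀ b c k f, DifferentiableAt ℝ (fun y => G y b k * G y c f) x :=
    fun b c k f => (hg _ _).fun_mul (hg _ _)
  have hcov : ∀ (a : Fin (d + 1)) (b c : Fin d) k f,
      cov2 G (fun y => riem G y b.succ c.succ) x a k f
      = pd a P x * (G x b.succ k * G x c.succ f - G x c.succ k * G x b.succ f)
        + P x * ((christoffelLow G x a b.succ k * G x c.succ f
            + G x b.succ k * christoffelLow G x a c.succ f)
          - (christoffelLow G x a c.succ k * G x b.succ f
            + G x c.succ k * christoffelLow G x a b.succ f)) := by
    intro a b c k f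
    rw [cov2_congr h.metric.isOpen hx (fun y hy => hriem y hy b c),
      cov2_smul hPd (fun k l => (hgg _ _ _ _).fun_add ((hgg _ _ _ _).const_mul _)),
      cov2_add (fun k l => hgg _ _ _ _) (fun k l => (hgg _ _ _ _).const_mul _),
      cov2_smul (f := fun _ => (-1 : ℝ)) (differentiableAt_const _) (fun k l => hgg _ _ _ _),
      cov2_tmul (v := fun y => G y b.succ) (w := fun y => G y c.succ) (fun k => hg _ _)
        (fun k => hg _ _),
      cov2_tmul (v := fun y => G y c.succ) (w := fun y => G y b.succ) (fun k => hg _ _)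
        (fun k => hg _ _), hrow, hrow, hrow, hrow, pd_const]
    ring
  -- The undifferentiated `P` terms of the Bianchi identity cancel by the symmetry of the
  -- Christoffel symbols in the labels.
  have hB : ∀ k f, pd μ.succ P x * (G x ν.succ k * G x ρ.succ f - G x ρ.succ k * G x ν.succ f)
      + pd ν.succ P x * (G x ρ.succ k * G x μ.succ f - G x μ.succ k * G x ρ.succ f)
      + pd ρ.succ P x * (G x μ.succ k * G x ν.succ f - G x ν.succ k * G x μ.succ f) = 0 := by
    intro k f
    have := h.metric.bianchi hx ν.succ ρ.succ μ.succ k f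
    rw [hcov, hcov, hcov] at this
    simp only [h.metric.christoffelLow_symm hx ν.succ μ.succ,
      h.metric.christoffelLow_symm hx ρ.succ μ.succ,
      h.metric.christoffelLow_symm hx ρ.succ ν.succ] at this
    linear_combination this
  have hI : ∀ (σ τ : Fin d), ∑ k, gInv G x τ.succ k * G x σ.succ k = if τ = σ then 1 else 0 := by
    intro σ τ
    simp only [h.metric.symm x hx σ.succ, h.metric.sum_gInv_mul hx, Fin.succ_inj]
  -- Contracting `k` with row `ν` of the inverse metric, and then `f` with row `ρ`, isolates `∂_μ P`
  -- because the three directions are distinct.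
  have hB1 : ∀ f, pd μ.succ P x * G x ρ.succ f - pd ρ.succ P x * G x μ.succ f = 0 := by
    intro f
    have e : ∑ k, gInv G x ν.succ k
        * (pd μ.succ P x * (G x ν.succ k * G x ρ.succ f - G x ρ.succ k * G x ν.succ f)
      + pd ν.succ P x * (G x ρ.succ k * G x μ.succ f - G x μ.succ k * G x ρ.succ f)
      + pd ρ.succ P x * (G x μ.succ k * G x ν.succ f - G x ν.succ k * G x μ.succ f))
      = (pd μ.succ P x * G x ρ.succ f - pd ρ.succ P x * G x μ.succ f)
          * ∑ k, gInv G x ν.succ k * G x ν.succ k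
        + (pd ν.succ P x * G x μ.succ f - pd μ.succ P x * G x ν.succ f)
          * ∑ k, gInv G x ν.succ k * G x ρ.succ k
        + (pd ρ.succ P x * G x ν.succ f - pd ν.succ P x * G x ρ.succ f)
          * ∑ k, gInv G x ν.succ k * G x μ.succ k := by
      simp only [Finset.mul_sum]
      rw [← Finset.sum_add_distrib, ← Finset.sum_add_distrib]
      exact Finset.sum_congr rfl fun k _ => by ring
    simp only [hB, hI, hν, Ne.symm hρ.2, if_true, if_false] at e
    simpa using e.symm
  have hB2 : pd μ.succ P x = 0 := by
    have e : ∑ f, gInv G x ρ.succ f * (pd μ.succ P x * G x ρ.succ f - pd ρ.succ P x * G x μ.succ f)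
      = pd μ.succ P x * ∑ f, gInv G x ρ.succ f * G x ρ.succ f
        - pd ρ.succ P x * ∑ f, gInv G x ρ.succ f * G x μ.succ f := by
      simp only [Finset.mul_sum]
      rw [← Finset.sum_sub_distrib]
      exact Finset.sum_congr rfl fun k _ => by ring
    simp only [hB1, hI, hρ.1, if_true, if_false] at e
    simpa using e.symm
  rw [hP] at hB2
  have : ((d : ℝ) * (d - 1))⁻¹ ≠ 0 := inv_ne_zero (mul_ne_zero hd0 hd1)
  exact (mul_eq_zero.1 hB2).resolve_left this

end IsComovingMetric

theorem pd_comp_coord {n : ℕ} {F : ℝ → ℝ} {x : Coord n} (j : Fin n)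
    (hF : DifferentiableAt ℝ F (x j)) (i : Fin n) :
    pd i (fun y => F (y j)) x = if j = i then deriv F (x j) else 0 := by
  have h := hF.hasDerivAt.comp_hasFDerivAt x (EuclideanSpace.proj j : Coord n →L[ℝ] ℝ).hasFDerivAt
  have h2 : fderiv ℝ (fun y : Coord n => F (y j)) x
    = deriv F (x j) • (EuclideanSpace.proj j : Coord n →L[ℝ] ℝ) := h.fderiv
  rw [pd, h2]
  simp

/-! ### Transition maps between charts. -/

section Transition

variable {n : ℕ} {M : Type*} [TopologicalSpace M]

/-- The change of coordinates from the chart `e` to the chart `e'`. -/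
def transition (e e' : OpenPartialHomeomorph M (Coord n)) (x : Coord n) : Coord n := e' (e.symm x)

/-- The coordinate vector field `∂ᵢ` as a vector of the model space. -/
def modelCoordVec [ChartedSpace (Coord n) M] (e : OpenPartialHomeomorph M (Coord n)) (x : Coord n)
    (i : Fin n) : Coord n :=
  coordVec e x i

/-- The coordinates in the chart `e` of the points that are also in the domain of `e'`. -/
def overlap (e e' : OpenPartialHomeomorph M (Coord n)) : Set (Coord n) :=
  e.target ∩ e.symm ⁻¹' e'.source

variable {e e' : OpenPartialHomeomorph M (Coord n)} {x : Coord n}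

theorem isOpen_overlap : IsOpen (overlap e e') :=
  e.isOpen_inter_preimage_symm e'.open_source

theorem mapsTo_transition : Set.MapsTo (transition e e') (overlap e e') e'.target :=
  fun _ hx => e'.map_source hx.2

theorem symm_transition (hx : x ∈ overlap e e') : e'.symm (transition e e' x) = e.symm x :=
  e'.left_inv hx.2

theorem transition_mem_overlap (hx : x ∈ overlap e e') : transition e e' x ∈ overlap e' e := by
  refine ⟨mapsTo_transition hx, ?_⟩
  rw [Set.mem_preimage, symm_transition hx]
  exact e.map_target hx.1

theorem transition_transition (hx : x ∈ overlap e e') :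
    transition e' e (transition e e' x) = x := by
  rw [transition, symm_transition hx, e.right_inv hx.1]

variable [ChartedSpace (Coord n) M]
  (he : e ∈ IsManifold.maximalAtlas (𝓡 n) ∞ M) (he' : e' ∈ IsManifold.maximalAtlas (𝓡 n) ∞ M)
include he

theorem contDiffOn_comp_symm {a : M → ℝ} (ha : ContMDiff (𝓡 n) 𝓘(ℝ, ℝ) ∞ a) :
    ContDiffOn ℝ ∞ (fun y => a (e.symm y)) e.target :=
  contMDiffOn_iff_contDiffOn.1 (ha.comp_contMDiffOn (contMDiffOn_symm_of_mem_maximalAtlas he))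

include he'

theorem contDiffOn_transition : ContDiffOn ℝ ∞ (transition e e') (overlap e e') := by
  have h1 := (contMDiffOn_symm_of_mem_maximalAtlas he).mono
    (Set.inter_subset_left : overlap e e' ⊆ e.target)
  have h2 := contMDiffOn_of_mem_maximalAtlas he'
  exact contMDiffOn_iff_contDiffOn.1 (h2.comp h1 fun x hx => hx.2)

/-- The chain rule for the two mutually inverse transition maps makes their Jacobians inverse
matrices. -/
theorem isUnit_det_jac_transition (hx : x ∈ overlap e e') :
    IsUnit (Matrix.of (jac (transition e e') x)).det := by
  have hy := transition_mem_overlap hx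
  have h1 := contDiffOn_transition he he'
  have h2 := contDiffOn_transition he' he
  have hcoord : ∀ a, ContDiffOn ℝ ∞ (fun y => transition e' e y a) (overlap e' e) := fun a =>
    (EuclideanSpace.proj a : Coord n →L[ℝ] ℝ).contDiff.comp_contDiffOn h2
  have hmul : Matrix.of (jac (transition e' e) (transition e e' x))
      * Matrix.of (jac (transition e e') x) = 1 := by
    ext a i
    have hc := pd_comp (F := fun y => transition e' e y a) (ψ := transition e e')
      ((hcoord a).differentiableAt_of_isOpen isOpen_overlap hy)
      ((h1.contDiffAt (isOpen_overlap.mem_nhds hx)).differentiableAt (by simp)) i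
    rw [pd_congr isOpen_overlap hx (g := fun y => y a)
      (fun y hy => by rw [transition_transition hy])] at hc
    have hid : pd i (fun y : Coord n => y a) x = if a = i then 1 else 0 := by
      simpa using pd_comp_coord (F := fun t => t) (x := x) a differentiableAt_fun_id i
    rw [hid] at hc
    rw [Matrix.mul_apply, Matrix.one_apply, hc]
    exact Finset.sum_congr rfl fun b _ => mul_comm _ _
  have := congrArg Matrix.det hmul
  rw [Matrix.det_mul, Matrix.det_one] at this
  exact IsUnit.of_mul_eq_one_right _ this

theorem modelCoordVec_eq_sum (hx : x ∈ overlap e e') (i : Fin n) :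
    modelCoordVec e x i
      = ∑ a, jac (transition e e') x a i • modelCoordVec e' (transition e e' x) a := by
  have hψ : DifferentiableAt ℝ (transition e e') x :=
    ((contDiffOn_transition he he').contDiffAt (isOpen_overlap.mem_nhds hx)).differentiableAt
      (by simp)
  have hy := mapsTo_transition hx
  have hs : MDifferentiableAt (𝓡 n) (𝓡 n) e'.symm (transition e e' x) :=
    ((contMDiffOn_symm_of_mem_maximalAtlas he').contMDiffAt
      (e'.open_target.mem_nhds hy)).mdifferentiableAt (by simp)
  have hev : e.symm =ᶠ[nhds x] e'.symm ∘ transition e e' :=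
    Filter.eventuallyEq_of_mem (isOpen_overlap.mem_nhds hx) fun y hy => (symm_transition hy).symm
  have h1 : mfderiv (𝓡 n) (𝓡 n) e.symm x
      = (mfderiv (𝓡 n) (𝓡 n) e'.symm (transition e e' x)).comp
        (mfderiv (𝓡 n) (𝓡 n) (transition e e') x) := by
    rw [← mfderiv_comp x hs hψ.mdifferentiableAt]
    exact hev.mfderiv_eq
  have hv : fderiv ℝ (transition e e') x (EuclideanSpace.single i 1)
      = ∑ a, jac (transition e e') x a i • (EuclideanSpace.single a 1 : Coord n) := by
    ext j
    have : jac (transition e e') x j i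
        = (fderiv ℝ (transition e e') x (EuclideanSpace.single i 1)) j := by
      have := ((EuclideanSpace.proj j : Coord n →L[ℝ] ℝ).hasFDerivAt.comp x hψ.hasFDerivAt).fderiv
      unfold jac pd
      change fderiv ℝ ((EuclideanSpace.proj j : Coord n →L[ℝ] ℝ) ∘ transition e e') x _ = _
      rw [this]; rfl
    rw [← this]
    simp [Finset.sum_apply, Pi.single_apply]
  let L : Coord n →L[ℝ] Coord n := mfderiv (𝓡 n) (𝓡 n) e'.symm (transition e e' x)
  have h2 : modelCoordVec e x i
      = L (fderiv ℝ (transition e e') x (EuclideanSpace.single i 1)) := by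
    unfold modelCoordVec coordVec
    rw [h1, mfderiv_eq_fderiv]
    rfl
  rw [h2, hv, map_sum]
  exact Finset.sum_congr rfl fun a _ => map_smul L _ _

end Transition

/-! ### Chart components of the metric and of the velocity covector. -/

section Metric

variable {n : ℕ} {M : Type*} [TopologicalSpace M] [ChartedSpace (Coord n) M]
  (g : LorentzMetric n M) {e e' : OpenPartialHomeomorph M (Coord n)}
  {x : Coord n} (he : e ∈ IsManifold.maximalAtlas (𝓡 n) ∞ M)
  (he' : e' ∈ IsManifold.maximalAtlas (𝓡 n) ∞ M)

/-- The metric as a field of bilinear forms on the model space. -/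
def LorentzMetric.modelForm (g : LorentzMetric n M) (p : M) : Coord n →L[ℝ] Coord n →L[ℝ] ℝ :=
  g.form p

include he he'

theorem LorentzMetric.comp_eq_sum (hx : x ∈ overlap e e') (i j : Fin n) :
    g.comp e x i j = ∑ a, ∑ b, jac (transition e e') x a i * jac (transition e e') x b j
      * g.comp e' (transition e e' x) a b := by
  have h1 : g.comp e x i j = g.modelForm (e.symm x) (modelCoordVec e x i)
    (modelCoordVec e x j) := rfl
  have h2 : ∀ a b, g.comp e' (transition e e' x) a b = g.modelForm (e.symm x)
      (modelCoordVec e' (transition e e' x) a)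
      (modelCoordVec e' (transition e e' x) b) := by
    intro a b
    rw [← symm_transition hx]
    rfl
  rw [h1, modelCoordVec_eq_sum he he' hx, modelCoordVec_eq_sum he he' hx]
  simp only [h2, map_sum, _root_.sum_apply, map_smul, _root_.smul_apply,
    smul_eq_mul, Finset.mul_sum]
  rw [Finset.sum_comm]
  exact Finset.sum_congr rfl fun a _ => Finset.sum_congr rfl fun b _ => by ring

theorem LorentzMetric.lower_eq_sum (u : ∀ p : M, TangentSpace (𝓡 n) p) (hx : x ∈ overlap e e')
    (k : Fin n) :
    g.lower u e x k = ∑ a, jac (transition e e') x a k * g.lower u e' (transition e e' x) a := by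
  have h1 : g.lower u e x k = g.modelForm (e.symm x) (u (e.symm x) : Coord n)
    (modelCoordVec e x k) := rfl
  have h2 : ∀ a, g.lower u e' (transition e e' x) a = g.modelForm (e.symm x)
      (u (e.symm x) : Coord n) (modelCoordVec e' (transition e e' x) a) := by
    intro a
    rw [← symm_transition hx]
    rfl
  rw [h1, modelCoordVec_eq_sum he he' hx]
  simp only [h2, map_sum, map_smul, smul_eq_mul]

end Metric

theorem contMDiff_of_contDiffOn_symm {n : ℕ} {M : Type*} [TopologicalSpace M]
    [ChartedSpace (Coord n) M] {a : M → ℝ}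
    (h : ∀ p : M, ∃ e ∈ IsManifold.maximalAtlas (𝓡 n) ∞ M, p ∈ e.source ∧
      ContDiffOn ℝ ∞ (fun y => a (e.symm y)) e.target) :
    ContMDiff (𝓡 n) 𝓘(ℝ, ℝ) ∞ a := by
  intro p
  obtain ⟨e, he, hp, ha⟩ := h p
  have h1 := (contMDiffOn_iff_contDiffOn.2 ha).comp (contMDiffOn_of_mem_maximalAtlas he)
    (fun q hq => e.map_source hq)
  refine (h1.contMDiffAt (e.open_source.mem_nhds hp)).congr_of_eventuallyEq ?_
  exact Filter.eventuallyEq_of_mem (e.open_source.mem_nhds hp) fun q hq => by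
    simp [e.left_inv hq]

theorem IsMetricOn.mono {n : ℕ} {G : MetricComp n} {Ω Ω' : Set (Coord n)} (h : IsMetricOn G Ω)
    (hΩ' : IsOpen Ω') (hs : Ω' ⊆ Ω) : IsMetricOn G Ω' :=
  ⟨hΩ', fun i j => (h.smooth i j).mono hs, fun x hx => h.symm x (hs hx),
    fun x hx => h.isUnit_det x (hs hx)⟩

/-! ### From comoving charts to arbitrary charts. -/

section GRW

variable {d : ℕ} {M : Type*} [TopologicalSpace M] [ChartedSpace (Coord (d + 1)) M]
  {g : LorentzMetric (d + 1) M} {u : ∀ p : M, TangentSpace (𝓡 (d + 1)) p}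
  {e : OpenPartialHomeomorph M (Coord (d + 1))}

theorem IsComovingChart.lower_eq (h : IsComovingChart g u e) {x : Coord (d + 1)}
    (hx : x ∈ e.target) : g.lower u e x = comovingU x := by
  obtain ⟨_, _, _, _, _, _, _, _, _, _, _, _, _, hc⟩ := h
  obtain ⟨hu, h00, h0, _⟩ := hc x hx
  have key : ∀ k, g.lower u e x k = g.comp e x 0 k := by
    intro k
    unfold LorentzMetric.lower
    rw [hu]
    rfl
  funext k
  rw [key]
  refine Fin.cases ?_ (fun μ => ?_) k
  · simp [h00, comovingU]
  · simp [h0, comovingU]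

/-- The projection to the spatial coordinates as a continuous linear map. -/
def spatialCLM (d : ℕ) : Coord (d + 1) →L[ℝ] Coord d :=
  LinearMap.toContinuousLinearMap
    { toFun := spatial
      map_add' := fun _ _ => rfl
      map_smul' := fun _ _ => rfl }

/-- The rate is `q'/q`, because `∂_t (q² h) = 2 (q'/q) q² h`. -/
theorem IsComovingChart.exists_isComovingMetric (h : IsComovingChart g u e) :
    ∃ φ, IsComovingMetric (g.comp e) φ e.target := by
  obtain ⟨he, J, V, q, H, hJ, _, hV, htar, hq, hqpos, hH, hpos, hc⟩ := h
  have hJx : ∀ x ∈ e.target, x 0 ∈ J := fun x hx => by rw [htar] at hx; exact hx.1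
  have hVx : ∀ x ∈ e.target, spatial x ∈ V := fun x hx => by rw [htar] at hx; exact hx.2
  have hq' : ContDiffOn ℝ ∞ (deriv q) J := hq.deriv_of_isOpen hJ (by simp)
  have hqd : ∀ t ∈ J, DifferentiableAt ℝ q t := fun t ht =>
    (hq.contDiffAt (hJ.mem_nhds ht)).differentiableAt (by simp)
  let F : ℝ → ℝ := fun t => deriv q t / q t
  have hF : ContDiffOn ℝ ∞ F J := hq'.div hq fun t ht => (hqpos t ht).ne'
  have hsymm : ∀ x i j, g.comp e x i j = g.comp e x j i := fun x i j => g.symm _ _ _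
  have hzero : ∀ x ∈ e.target, ∀ k, g.comp e x 0 k = comovingU x k := by
    intro x hx k
    refine Fin.cases ?_ (fun μ => ?_) k
    · simp [(hc x hx).2.1, comovingU]
    · simp [(hc x hx).2.2.1, comovingU]
  refine ⟨fun x => F (x 0), ⟨e.open_target, g.smooth e he, fun x _ => hsymm x, fun x hx => ?_⟩,
    hzero, fun x hx i j => ?_, ?_, fun x hx μ => ?_⟩
  · rw [isUnit_iff_ne_zero]
    -- A kernel vector has zero time component by the row `g_{0k}`, and its spatial part is then
    -- annihilated by the positive definite matrix `H`.
    intro hdet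
    obtain ⟨v, hv, hv0⟩ := Matrix.exists_mulVec_eq_zero_iff.2 hdet
    have hrow : ∀ i, ∑ j, g.comp e x i j * v j = 0 := fun i => congrFun hv0 i
    have h0 : v 0 = 0 := by
      have := hrow 0
      simp only [hzero x hx] at this
      simpa [comovingU] using this
    have hs : (H (spatial x)).mulVec (fun μ => v μ.succ) = 0 := by
      funext μ
      have := hrow μ.succ
      rw [Fin.sum_univ_succ, h0] at this
      simp only [(hc x hx).2.2.2, mul_zero, zero_add, mul_assoc, ← Finset.mul_sum] at this
      exact (mul_eq_zero.1 this).resolve_left (pow_pos (hqpos _ (hJx x hx)) 2).ne'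
    have hs0 := Matrix.eq_zero_of_mulVec_eq_zero (hpos _ (hVx x hx)).det_pos.ne' hs
    apply hv
    funext k
    refine Fin.cases h0 (fun μ => congrFun hs0 μ) k
  · have hconst : ∀ k, pd 0 (fun y => g.comp e y 0 k) x = 0 := fun k => by
      rw [pd_congr e.open_target hx (fun y hy => hzero y hy k)]
      exact pd_const 0 _
    have h0 : comovingU x 0 = -1 := by simp [comovingU]
    refine Fin.cases ?_ (fun μ => ?_) i
    · rw [hconst, hzero x hx, h0]; ring
    refine Fin.cases ?_ (fun ν => ?_) j
    · rw [pd_congr e.open_target hx (fun y _ => hsymm y μ.succ 0), hconst, hsymm, hzero x hx, h0]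
      ring
    have hHd : DifferentiableAt ℝ (fun y => H y μ ν) (spatialCLM d x) :=
      ((hH μ ν).contDiffAt (hV.mem_nhds (hVx x hx))).differentiableAt (by simp)
    have hHs : HasFDerivAt (fun y => H (spatial y) μ ν) _ x :=
      hHd.hasFDerivAt.comp x (spatialCLM d).hasFDerivAt
    have hH0 : pd 0 (fun y => H (spatial y) μ ν) x = 0 := by
      rw [pd, hHs.fderiv, ContinuousLinearMap.comp_apply]
      have : spatialCLM d (EuclideanSpace.single 0 1) = 0 := by
        ext ν
        change (EuclideanSpace.single (0 : Fin (d + 1)) (1 : ℝ)) ν.succ = 0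
        simp
      rw [this, map_zero]
    have hqx := hqd _ (hJx x hx)
    have hq2 : DifferentiableAt ℝ (fun y : Coord (d + 1) => q (y 0) ^ 2) x := by
      refine DifferentiableAt.pow ?_ 2
      exact hqx.comp x (EuclideanSpace.proj 0 : Coord (d + 1) →L[ℝ] ℝ).differentiableAt
    rw [pd_congr e.open_target hx (fun y hy => (hc y hy).2.2.2 μ ν),
      pd_mul hq2 hHs.differentiableAt, hH0, (hc x hx).2.2.2,
      pd_comp_coord (F := fun t => q t ^ 2) 0 (hqx.pow 2)]
    have hd2 : deriv (fun t => q t ^ 2) (x 0) = 2 * q (x 0) * deriv q (x 0) := by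
      have := (hqx.hasDerivAt.fun_pow 2).deriv
      simpa using this
    have hne := (hqpos _ (hJx x hx)).ne'
    simp only [if_true, hd2, F, comovingU, Fin.succ_ne_zero, if_false]
    field_simp
    ring
  · exact hF.comp (EuclideanSpace.proj 0 : Coord (d + 1) →L[ℝ] ℝ).contDiff.contDiffOn hJx
  · rw [pd_comp_coord 0 ((hF.contDiffAt (hJ.mem_nhds (hJx x hx))).differentiableAt (by simp))]
    simp [(Fin.succ_ne_zero μ).symm]

/-- Nondegeneracy is inherited from a comoving chart through the congruence `G = Jᵀ G' J`. -/
theorem IsGRW.isMetricOn_comp (h : IsGRW g u)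
    (he : e ∈ IsManifold.maximalAtlas (𝓡 (d + 1)) ∞ M) : IsMetricOn (g.comp e) e.target := by
  refine ⟨e.open_target, g.smooth e he, fun x _ i j => g.symm _ _ _, fun x hx => ?_⟩
  obtain ⟨e', hc, hp⟩ := h (e.symm x)
  obtain ⟨φ, hφ⟩ := hc.exists_isComovingMetric
  have ho : x ∈ overlap e e' := ⟨hx, hp⟩
  have hJ := isUnit_det_jac_transition he hc.1 ho
  have : g.comp e x = (Matrix.of (jac (transition e e') x)).transpose
      * g.comp e' (transition e e' x) * Matrix.of (jac (transition e e') x) := by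
    ext i j
    rw [g.comp_eq_sum he hc.1 ho]
    simp only [Matrix.mul_apply, Matrix.transpose_apply, Matrix.of_apply, Finset.sum_mul]
    rw [Finset.sum_comm]
    exact Finset.sum_congr rfl fun a _ => Finset.sum_congr rfl fun b _ => by ring
  rw [this, Matrix.det_mul, Matrix.det_mul, Matrix.det_transpose]
  exact (hJ.mul (hφ.metric.isUnit_det _ (mapsTo_transition ho))).mul hJ

theorem IsGRW.isCoordChange (h : IsGRW g u) {e' : OpenPartialHomeomorph M (Coord (d + 1))}
    (he : e ∈ IsManifold.maximalAtlas (𝓡 (d + 1)) ∞ M)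
    (he' : e' ∈ IsManifold.maximalAtlas (𝓡 (d + 1)) ∞ M) :
    IsCoordChange (g.comp e) (g.comp e') (transition e e') (overlap e e') e'.target :=
  ⟨(h.isMetricOn_comp he).mono isOpen_overlap Set.inter_subset_left, h.isMetricOn_comp he',
    mapsTo_transition, contDiffOn_transition he he',
    fun _ hx => isUnit_det_jac_transition he he' hx, fun _ hx => g.comp_eq_sum he he' hx⟩

end GRW

/-! ### Global scalars that depend on time only, and their derivatives along the velocity. -/

section TimeScalars

variable {d : ℕ} {M : Type*} [TopologicalSpace M] [ChartedSpace (Coord (d + 1)) M]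

theorem differentiableAt_comp_symm {n : ℕ} {M : Type*} [TopologicalSpace M]
    [ChartedSpace (Coord n) M] {e : OpenPartialHomeomorph M (Coord n)}
    (he : e ∈ IsManifold.maximalAtlas (𝓡 n) ∞ M) {a : M → ℝ}
    (ha : ContMDiff (𝓡 n) 𝓘(ℝ, ℝ) ∞ a) {x : Coord n} (hx : x ∈ e.target) :
    DifferentiableAt ℝ (fun y => a (e.symm y)) x :=
  (contDiffOn_comp_symm he ha).differentiableAt_of_isOpen e.open_target hx

/-- The smooth scalar fields that only depend on time in every comoving chart. -/
def timeScalars (g : LorentzMetric (d + 1) M) (u : ∀ p : M, TangentSpace (𝓡 (d + 1)) p) :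
    Subalgebra ℝ (M → ℝ) where
  carrier := {a | ContMDiff (𝓡 (d + 1)) 𝓘(ℝ, ℝ) ∞ a ∧ ∀ e, IsComovingChart g u e →
    ∀ x ∈ e.target, ∀ μ : Fin d, pd μ.succ (fun y => a (e.symm y)) x = 0}
  mul_mem' := by
    rintro a b ⟨ha, ha'⟩ ⟨hb, hb'⟩
    refine ⟨ha.mul hb, fun e he x hx μ => ?_⟩
    have := pd_mul (differentiableAt_comp_symm he.1 ha hx) (differentiableAt_comp_symm he.1 hb hx)
      μ.succ
    rw [ha' e he x hx, hb' e he x hx] at this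
    simpa using this
  add_mem' := by
    rintro a b ⟨ha, ha'⟩ ⟨hb, hb'⟩
    refine ⟨ha.add hb, fun e he x hx μ => ?_⟩
    have := pd_add (differentiableAt_comp_symm he.1 ha hx) (differentiableAt_comp_symm he.1 hb hx)
      μ.succ
    rw [ha' e he x hx, hb' e he x hx] at this
    simpa using this
  algebraMap_mem' := fun c => ⟨contMDiff_const, fun _ _ _ _ _ => pd_const _ _⟩

variable {g : LorentzMetric (d + 1) M} {u : ∀ p : M, TangentSpace (𝓡 (d + 1)) p}

theorem contMDiff_timeScalars (a : timeScalars g u) :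
    ContMDiff (𝓡 (d + 1)) 𝓘(ℝ, ℝ) ∞ (a : M → ℝ) := a.2.1

theorem isPerfectFluid_of_timeScalars {S : MetricComp (d + 1) → Coord (d + 1) →
      Fin (d + 1) → Fin (d + 1) → ℝ} (a b : timeScalars g u)
    (h : ∀ e ∈ IsManifold.maximalAtlas (𝓡 (d + 1)) ∞ M, ∀ x ∈ e.target, ∀ k l,
      S (g.comp e) x k l = (a : M → ℝ) (e.symm x) * g.comp e x k l
        + (b : M → ℝ) (e.symm x) * (g.lower u e x k * g.lower u e x l)) :
    IsPerfectFluid g u S :=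
  ⟨a, b, contMDiff_timeScalars a, contMDiff_timeScalars b, h⟩

theorem IsComovingChart.lower_eq_sum {e e' : OpenPartialHomeomorph M (Coord (d + 1))}
    (hc : IsComovingChart g u e') (he : e ∈ IsManifold.maximalAtlas (𝓡 (d + 1)) ∞ M)
    {x : Coord (d + 1)} (hx : x ∈ overlap e e') (k : Fin (d + 1)) :
    g.lower u e x k
      = ∑ a, jac (transition e e') x a k * comovingU (transition e e' x) a := by
  rw [g.lower_eq_sum he hc.1 u hx, hc.lower_eq (mapsTo_transition hx)]

namespace IsGRW

variable (h : IsGRW g u) {e : OpenPartialHomeomorph M (Coord (d + 1))}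
include h

theorem smooth_lower (he : e ∈ IsManifold.maximalAtlas (𝓡 (d + 1)) ∞ M) (k : Fin (d + 1)) :
    ContDiffOn ℝ ∞ (fun y => g.lower u e y k) e.target := by
  intro x hx
  obtain ⟨e', hc, hp⟩ := h (e.symm x)
  have ho : x ∈ overlap e e' := ⟨hx, hp⟩
  have hs : ContDiffOn ℝ ∞ (fun y => g.lower u e y k) (overlap e e') := by
    refine ContDiffOn.congr (f := fun y => ∑ a, jac (transition e e') y a k
      * (if a = 0 then -1 else 0)) ?_ fun y hy => hc.lower_eq_sum he hy k
    exact ContDiffOn.sum fun a _ =>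
      ((h.isCoordChange he hc.1).smooth_jac a k).mul contDiffOn_const
  exact (hs.contDiffAt (isOpen_overlap.mem_nhds ho)).contDiffWithinAt

theorem contr_lower (he : e ∈ IsManifold.maximalAtlas (𝓡 (d + 1)) ∞ M) {x : Coord (d + 1)}
    (hx : x ∈ e.target) :
    contr (g.comp e) x (fun a b => g.lower u e x a * g.lower u e x b) = -1 := by
  obtain ⟨e', hc, hp⟩ := h (e.symm x)
  obtain ⟨φ, hφ⟩ := hc.exists_isComovingMetric
  have ho : x ∈ overlap e e' := ⟨hx, hp⟩
  have hcc := h.isCoordChange he hc.1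
  set J := Matrix.of (jac (transition e e') x) with hJ
  have hJV : ∀ a, ∑ b, jac (transition e e') x a b * J⁻¹ b 0 = if a = 0 then 1 else 0 := by
    intro a
    have := congrFun (congrFun (Matrix.mul_nonsing_inv J (hcc.isUnit_det x ho)) a) 0
    simpa [Matrix.mul_apply, Matrix.one_apply, hJ] using this
  -- Column `0` of the inverse Jacobian holds the contravariant components of `u`, the time
  -- coordinate vector of the comoving chart. Raising an index reduces the norm of `u` to the
  -- component `u_0 = -1` there.
  have hu : ∀ k, g.lower u e x k = ∑ b, J⁻¹ b 0 * g.comp e x b k := by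
    intro k
    have e1 : ∀ b, J⁻¹ b 0 * g.comp e x b k = ∑ c, ∑ a, jac (transition e e') x c k
        * g.comp e' (transition e e' x) a c * (jac (transition e e') x a b * J⁻¹ b 0) := by
      intro b
      rw [hcc.pullback x ho, Finset.mul_sum, Finset.sum_comm]
      refine Finset.sum_congr rfl fun a _ => ?_
      rw [Finset.mul_sum]
      exact Finset.sum_congr rfl fun c _ => by ring
    simp only [e1]
    rw [Finset.sum_comm, hc.lower_eq_sum he ho]
    refine Finset.sum_congr rfl fun c _ => ?_
    rw [Finset.sum_comm]
    simp only [← Finset.mul_sum, hJV]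
    simp [hφ.zero_left _ (mapsTo_transition ho)]
  have hm := h.isMetricOn_comp he
  have e2 : contr (g.comp e) x (fun a b => g.lower u e x a * g.lower u e x b)
      = ∑ k, J⁻¹ k 0 * contr (g.comp e) x (fun a b => g.comp e x k a * g.lower u e x b) := by
    simp only [contr, Finset.mul_sum]
    refine (Finset.sum_congr rfl fun a _ => Finset.sum_congr rfl fun b _ => ?_).trans
      ((Finset.sum_congr rfl fun _ _ => Finset.sum_comm).trans Finset.sum_comm)
    rw [hu a, Finset.sum_mul, Finset.mul_sum]
    exact Finset.sum_congr rfl fun k _ => by ring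
  rw [e2]
  simp only [hm.contr_metric_mul hx, hc.lower_eq_sum he ho]
  have e3 : ∑ k, J⁻¹ k 0 * ∑ a, jac (transition e e') x a k * comovingU (transition e e' x) a
      = ∑ a, comovingU (transition e e' x) a * ∑ k, jac (transition e e') x a k * J⁻¹ k 0 := by
    simp only [Finset.mul_sum]
    rw [Finset.sum_comm]
    exact Finset.sum_congr rfl fun a _ => Finset.sum_congr rfl fun k _ => by ring
  rw [e3]
  simp only [hJV]
  simp [comovingU]

/-- The trace recovers the expansion rate from `∇u` when `d ≠ 0`, which makes the rate independent
of the comoving chart used to define it. -/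
theorem contr_projector (he : e ∈ IsManifold.maximalAtlas (𝓡 (d + 1)) ∞ M)
    {x : Coord (d + 1)} (hx : x ∈ e.target) (r : ℝ) :
    contr (g.comp e) x (fun a b => r * (g.comp e x a b + g.lower u e x a * g.lower u e x b))
      = d * r := by
  have := contr_perfectFluid (h.isMetricOn_comp he) hx (h.contr_lower he hx) r r
  simp only [← mul_add] at this
  rw [this]
  push_cast
  ring

theorem cov1_lower {e' : OpenPartialHomeomorph M (Coord (d + 1))}
    (he : e ∈ IsManifold.maximalAtlas (𝓡 (d + 1)) ∞ M) (hc : IsComovingChart g u e')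
    {φ : Coord (d + 1) → ℝ} (hφ : IsComovingMetric (g.comp e') φ e'.target)
    {x : Coord (d + 1)} (hx : x ∈ overlap e e') (a k : Fin (d + 1)) :
    cov1 (g.comp e) (g.lower u e) x a k = φ (transition e e' x)
      * (g.comp e x a k + g.lower u e x a * g.lower u e x k) := by
  have hcc := h.isCoordChange he hc.1
  rw [hcc.cov1_pullback (w' := comovingU) (fun _ => contDiffOn_const)
    (fun y hy k => hc.lower_eq_sum he hy k) hx, hcc.pullback x hx, hc.lower_eq_sum he hx,
    hc.lower_eq_sum he hx]
  simp only [hφ.isTorseForming.cov1_eq _ (mapsTo_transition hx), Finset.sum_mul, Finset.mul_sum,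
    mul_add, ← Finset.sum_add_distrib]
  rw [Finset.sum_comm]
  simp only [mul_comm, mul_left_comm, mul_assoc, Finset.sum_add_distrib]
  congr 1
  rw [Finset.sum_comm]
  exact Finset.sum_congr rfl fun _ _ => Finset.sum_congr rfl fun _ _ => by ring

/-- The expansion rate is a global scalar field. -/
theorem exists_rate (hd : 0 < d) : ∃ φ : timeScalars g u,
    ∀ e ∈ IsManifold.maximalAtlas (𝓡 (d + 1)) ∞ M,
      IsTorseForming (g.comp e) (g.lower u e) (fun y => (φ : M → ℝ) (e.symm y)) e.target ∧
      (IsComovingChart g u e → IsComovingMetric (g.comp e) (fun y => (φ : M → ℝ) (e.symm y))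
        e.target) := by
  choose ch hch hmem using id h
  choose r hr using fun p => (hch p).exists_isComovingMetric
  -- At each point the rate is taken from the chart chosen for that point, so neither smoothness nor
  -- constancy along space is visible yet.
  let φ : M → ℝ := fun p => r p (ch p p)
  have hd0 : (d : ℝ) ≠ 0 := by positivity
  have hcov : ∀ e ∈ IsManifold.maximalAtlas (𝓡 (d + 1)) ∞ M, ∀ x ∈ e.target, ∀ a k,
      cov1 (g.comp e) (g.lower u e) x a k = φ (e.symm x)
        * (g.comp e x a k + g.lower u e x a * g.lower u e x k) := fun e he x hx a k =>
    h.cov1_lower he (hch (e.symm x)) (hr (e.symm x)) ⟨hx, hmem _⟩ a k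
  -- Any local rate satisfies the same equation for `∇u`, so the trace forces it to equal `φ`.
  -- Smoothness and vanishing spatial derivatives then pass from the local rate to `φ`.
  have hloc : ∀ e, IsComovingChart g u e → ∀ s, IsComovingMetric (g.comp e) s e.target →
      ∀ x ∈ e.target, s x = φ (e.symm x) := by
    intro e he s hs x hx
    have e1 : ∀ a k, s x * (g.comp e x a k + g.lower u e x a * g.lower u e x k)
        = φ (e.symm x) * (g.comp e x a k + g.lower u e x a * g.lower u e x k) := by
      intro a k
      have ho : x ∈ overlap e e := ⟨hx, e.map_target hx⟩
      rw [← hcov e he.1 x hx, h.cov1_lower he.1 he hs ho, transition, e.right_inv hx]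
    have e2 := h.contr_projector he.1 hx (s x)
    simp only [e1] at e2
    rw [h.contr_projector he.1 hx] at e2
    exact (mul_left_cancel₀ hd0 e2).symm
  have hcm : ∀ e, IsComovingChart g u e →
      IsComovingMetric (g.comp e) (fun y => φ (e.symm y)) e.target := by
    intro e he
    obtain ⟨s, hs⟩ := he.exists_isComovingMetric
    have heq := hloc e he s hs
    refine ⟨hs.metric, hs.zero_left, fun x hx i j => ?_,
      hs.smooth_rate.congr fun x hx => (heq x hx).symm, fun x hx μ => ?_⟩
    · rw [hs.pd_zero x hx, heq x hx]
    · rw [← pd_congr e.open_target hx heq, hs.pd_rate x hx]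
  have hsm : ContMDiff (𝓡 (d + 1)) 𝓘(ℝ, ℝ) ∞ φ := contMDiff_of_contDiffOn_symm fun p =>
    ⟨ch p, (hch p).1, hmem p, (hcm _ (hch p)).smooth_rate⟩
  refine ⟨⟨φ, hsm, fun e he x hx μ => (hcm e he).pd_rate x hx μ⟩, fun e he => ⟨?_, hcm e⟩⟩
  exact ⟨h.isMetricOn_comp he, h.smooth_lower he, contDiffOn_comp_symm he hsm,
    fun x hx => h.contr_lower he hx, hcov e he⟩

theorem pd_comp_symm {a : timeScalars g u} {e' : OpenPartialHomeomorph M (Coord (d + 1))}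
    (he : e ∈ IsManifold.maximalAtlas (𝓡 (d + 1)) ∞ M) (hc : IsComovingChart g u e')
    {x : Coord (d + 1)} (hx : x ∈ overlap e e') (k : Fin (d + 1)) :
    pd k (fun y => (a : M → ℝ) (e.symm y)) x
      = -pd 0 (fun y => (a : M → ℝ) (e'.symm y)) (transition e e' x) * g.lower u e x k := by
  have hy := mapsTo_transition hx
  have hs := contDiffOn_comp_symm hc.1 a.2.1
  rw [pd_congr isOpen_overlap hx
      (g := fun y => (fun z => (a : M → ℝ) (e'.symm z)) (transition e e' y))
      (fun y hy => by simp only [symm_transition hy]),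
    (h.isCoordChange he hc.1).pd_comp hs hx, hc.lower_eq_sum he hx, Fin.sum_univ_succ,
    Fin.sum_univ_succ]
  simp only [a.2.2 e' hc _ hy, comovingU, Fin.succ_ne_zero, if_true, if_false]
  simp [mul_comm]

/-- The derivative of a scalar field that only depends on time is such a field as well. -/
theorem exists_grad (a : timeScalars g u) : ∃ b : timeScalars g u,
    ∀ e ∈ IsManifold.maximalAtlas (𝓡 (d + 1)) ∞ M,
      IsGradAlong (g.lower u e) e.target (fun y => (a : M → ℝ) (e.symm y))
        (fun y => (b : M → ℝ) (e.symm y)) := by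
  choose ch hch hmem using id h
  -- Here too the chart depends on the point; `hgrad` characterizes `b` by the gradient of `a`, and
  -- evaluating it on `∂_t` in any comoving chart gives `hb`.
  let b : M → ℝ := fun p => -pd 0 (fun y => (a : M → ℝ) ((ch p).symm y)) (ch p p)
  have hgrad : ∀ e ∈ IsManifold.maximalAtlas (𝓡 (d + 1)) ∞ M, ∀ x ∈ e.target, ∀ k,
      pd k (fun y => (a : M → ℝ) (e.symm y)) x = b (e.symm x) * g.lower u e x k :=
    fun e he x hx k => h.pd_comp_symm he (hch (e.symm x)) ⟨hx, hmem _⟩ k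
  have hb : ∀ e, IsComovingChart g u e → ∀ x ∈ e.target,
      -pd 0 (fun y => (a : M → ℝ) (e.symm y)) x = b (e.symm x) := by
    intro e he x hx
    rw [hgrad e he.1 x hx, he.lower_eq hx]
    simp [comovingU]
  have hsm : ContMDiff (𝓡 (d + 1)) 𝓘(ℝ, ℝ) ∞ b := contMDiff_of_contDiffOn_symm fun p =>
    ⟨ch p, (hch p).1, hmem p, (contDiffOn_pd (ch p).open_target
      (contDiffOn_comp_symm (hch p).1 a.2.1) 0).neg.congr fun x hx => (hb _ (hch p) x hx).symm⟩
  refine ⟨⟨b, hsm, fun e he x hx μ => ?_⟩, fun e he =>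
    ⟨contDiffOn_comp_symm he a.2.1, hgrad e he⟩⟩
  rw [← pd_congr e.open_target hx (hb e he), pd_neg,
    pd_succ_pd_zero e.open_target (contDiffOn_comp_symm he.1 a.2.1) (a.2.2 e he) hx, neg_zero]

end IsGRW

end TimeScalars

/-! ### Scalar and Ricci curvature of a Robertson-Walker space-time. -/

section RobertsonWalker

variable {d : ℕ} {M : Type*} [TopologicalSpace M] [ChartedSpace (Coord (d + 1)) M]
  {g : LorentzMetric (d + 1) M} {u : ∀ p : M, TangentSpace (𝓡 (d + 1)) p}

theorem IsGradAlong.congr {n : ℕ} {v : Coord n → Fin n → ℝ} {Ω : Set (Coord n)}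
    {f f' f₁ : Coord n → ℝ} (h : IsGradAlong v Ω f f₁) (hΩ : IsOpen Ω)
    (hf : ∀ x ∈ Ω, f' x = f x) : IsGradAlong v Ω f' f₁ :=
  ⟨h.smooth.congr hf, fun x hx k => by rw [pd_congr hΩ hx hf, h.pd_eq x hx]⟩

/-- The scalar curvature of a Robertson-Walker space-time is a function of time, and its Ricci
tensor is a perfect fluid. -/
theorem IsRobertsonWalker.exists_scal (h : IsRobertsonWalker g u) (hd : 2 ≤ d)
    {φ φ₁ : timeScalars g u}
    (hφ : ∀ e, IsComovingChart g u e →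
      IsComovingMetric (g.comp e) (fun y => (φ : M → ℝ) (e.symm y)) e.target)
    (hφ₁ : ∀ e ∈ IsManifold.maximalAtlas (𝓡 (d + 1)) ∞ M,
      IsGradAlong (g.lower u e) e.target (fun y => (φ : M → ℝ) (e.symm y))
        (fun y => (φ₁ : M → ℝ) (e.symm y))) :
    ∃ R : timeScalars g u, ∀ e ∈ IsManifold.maximalAtlas (𝓡 (d + 1)) ∞ M, ∀ x ∈ e.target,
      scal (g.comp e) x = (R : M → ℝ) (e.symm x) ∧ ∀ k l, ric (g.comp e) x k l
        = ((R : M → ℝ) (e.symm x) / d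
            - ((φ : M → ℝ) (e.symm x) ^ 2 - (φ₁ : M → ℝ) (e.symm x))) * g.comp e x k l
          + ((R : M → ℝ) (e.symm x) / d
            - (d + 1) * ((φ : M → ℝ) (e.symm x) ^ 2 - (φ₁ : M → ℝ) (e.symm x)))
            * (g.lower u e x k * g.lower u e x l) := by
  obtain ⟨hG, hW, hC⟩ := h
  have hd0 : (d : ℝ) ≠ 0 := by
    have : 0 < d := by omega
    positivity
  choose ch hch hmem using id hG
  let R : M → ℝ := fun p => scal (g.comp (ch p)) (ch p p)
  have hric : ∀ e ∈ IsManifold.maximalAtlas (𝓡 (d + 1)) ∞ M, ∀ x ∈ e.target, ∀ k l,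
      ric (g.comp e) x k l
        = (R (e.symm x) / d
            - ((φ : M → ℝ) (e.symm x) ^ 2 - (φ₁ : M → ℝ) (e.symm x))) * g.comp e x k l
          + (R (e.symm x) / d
            - (d + 1) * ((φ : M → ℝ) (e.symm x) ^ 2 - (φ₁ : M → ℝ) (e.symm x)))
            * (g.lower u e x k * g.lower u e x l) := by
    intro e he x hx k l
    have hc := hch (e.symm x)
    have ho : x ∈ overlap e (ch (e.symm x)) := ⟨hx, hmem _⟩
    have hy := mapsTo_transition ho
    have hcc := hG.isCoordChange he hc.1
    have hR : R (e.symm x)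
        = scal (g.comp (ch (e.symm x))) (transition e (ch (e.symm x)) x) := rfl
    -- The chosen chart depends on `x`; it is replaced by a fixed comoving chart `e'`, keeping the
    -- value of `R` at the point, before the Ricci tensor is pulled back.
    generalize R (e.symm x) = r at hR ⊢
    generalize ch (e.symm x) = e' at hc ho hy hcc hR
    have hpd : pd 0 (fun y => (φ : M → ℝ) (e'.symm y)) (transition e e' x)
        = -(φ₁ : M → ℝ) (e.symm x) := by
      rw [(hφ₁ e' hc.1).pd_eq _ hy, hc.lower_eq hy, symm_transition ho]
      simp [comovingU]
    rw [hcc.ric_pullback ho, hcc.pullback x ho, hc.lower_eq_sum he ho, hc.lower_eq_sum he ho, hR]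
    simp only [(hφ e' hc).ric_eq hd hy (hW e' hc.1 _ hy), hpd, symm_transition ho,
      ← sub_eq_add_neg]
    rw [Finset.sum_mul, Finset.mul_sum, Finset.mul_sum, ← Finset.sum_add_distrib]
    refine Finset.sum_congr rfl fun a _ => ?_
    rw [Finset.mul_sum, Finset.mul_sum, Finset.mul_sum, ← Finset.sum_add_distrib]
    exact Finset.sum_congr rfl fun b _ => by ring
  -- The trace of the Ricci formula is `(d + 1) (R/d - ξ) - (R/d - (d + 1) ξ) = R` with `ξ = φ² -
  -- φ₁`, so the scalar curvature in every chart equals `R`.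
  have hscal : ∀ e ∈ IsManifold.maximalAtlas (𝓡 (d + 1)) ∞ M, ∀ x ∈ e.target,
      scal (g.comp e) x = R (e.symm x) := by
    intro e he x hx
    rw [scal_eq (hG.isMetricOn_comp he) hx (hG.contr_lower he hx) (hric e he x hx)]
    push_cast
    field_simp
    ring
  have hsm : ContMDiff (𝓡 (d + 1)) 𝓘(ℝ, ℝ) ∞ R := contMDiff_of_contDiffOn_symm fun p =>
    ⟨ch p, (hch p).1, hmem p, (hG.isMetricOn_comp (hch p).1).smooth_scal.congr
      fun x hx => (hscal _ (hch p).1 x hx).symm⟩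
  refine ⟨⟨R, hsm, fun e he x hx μ => ?_⟩, fun e he x hx => ⟨hscal e he x hx, hric e he x hx⟩⟩
  rw [← pd_congr e.open_target hx (hscal e he.1)]
  -- Dimension at least four uses the Bianchi identity; dimension three uses the Cotton tensor.
  rcases hd.lt_or_eq with hlt | heq
  · exact (hφ e he).pd_scal_of_three_le hlt hx (hW e he.1) μ
  · exact (hφ e he).pd_scal_of_cotton hd hx (hW e he.1) (hC (by omega) e he.1 x hx) μ

end RobertsonWalker

end QuadraticGravity

end

/-! ### Assembly of the coefficients. -/

theorem theorem7p1 {d : ℕ} (hd : 3 ≤ d + 1) {M : Type*} [TopologicalSpace M]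
    [ChartedSpace (EuclideanSpace ℝ (Fin (d + 1))) M] [IsManifold (𝓡 (d + 1)) ∞ M]
    (g : LorentzMetric (d + 1) M) (u : ∀ p : M, TangentSpace (𝓡 (d + 1)) p)
    (hRW : IsRobertsonWalker g u) :
    (∀ κ Λ₀ α β γ : ℝ, κ ≠ 0 → IsPerfectFluid g u (stressEnergy κ Λ₀ α β γ)) ∧
    IsPerfectFluid g u ric ∧
    IsPerfectFluid g u (fun G => hess G (scal G)) ∧
    IsPerfectFluid g u (fun G => box2 G (ric G)) ∧
    IsPerfectFluid g u ricRic ∧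
    IsPerfectFluid g u riemRic ∧
    IsPerfectFluid g u riemRiem := by
  obtain ⟨φ, hφ⟩ := hRW.1.exists_rate (by omega)
  choose D hD using hRW.1.exists_grad
  obtain ⟨R, hR⟩ := hRW.exists_scal (by omega) (fun e he => (hφ e he.1).2 he) (hD φ)
  have hT := fun e he => (hφ e he).1
  obtain ⟨A, B, hric⟩ : ∃ A B : timeScalars g u,
      ∀ e ∈ IsManifold.maximalAtlas (𝓡 (d + 1)) ∞ M, ∀ x ∈ e.target, ∀ k l,
      ric (g.comp e) x k l = (A : M → ℝ) (e.symm x) * g.comp e x k l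
        + (B : M → ℝ) (e.symm x) * (g.lower u e x k * g.lower u e x l) := by
    refine ⟨(d : ℝ)⁻¹ • R - (φ ^ 2 - D φ), (d : ℝ)⁻¹ • R - ((d : ℝ) + 1) • (φ ^ 2 - D φ),
      fun e he x hx k l => ?_⟩
    rw [(hR e he x hx).2]
    simp [div_eq_inv_mul]
  obtain ⟨P, Q, hriem⟩ : ∃ P Q : timeScalars g u,
      ∀ e ∈ IsManifold.maximalAtlas (𝓡 (d + 1)) ∞ M, ∀ x ∈ e.target, ∀ a b c f,
      riem (g.comp e) x a b c f = (P : M → ℝ) (e.symm x)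
          * (g.comp e x a c * g.comp e x b f - g.comp e x a f * g.comp e x b c)
        + (Q : M → ℝ) (e.symm x) * (g.comp e x a c * (g.lower u e x b * g.lower u e x f)
          - g.comp e x a f * (g.lower u e x b * g.lower u e x c)
          - g.comp e x b c * (g.lower u e x a * g.lower u e x f)
          + g.comp e x b f * (g.lower u e x a * g.lower u e x c)) := by
    -- These are the coefficients of `riem_of_weyl_eq_zero` with `n - 1 = d` and `n - 2 = d - 1`.
    refine ⟨(2 / ((d : ℝ) - 1)) • A - ((d : ℝ) * (d - 1))⁻¹ • R, ((d : ℝ) - 1)⁻¹ • B,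
      fun e he x hx a b c f => ?_⟩
    rw [riem_of_weyl_eq_zero (hRW.2.1 e he x hx) (hric e he x hx), (hR e he x hx).1]
    push_cast
    rw [show (d : ℝ) + 1 - 2 = d - 1 by ring, show (d : ℝ) + 1 - 1 = d by ring]
    simp only [Pi.sub_apply, Pi.smul_apply, smul_eq_mul]
    ring
  have hscal : ∀ e ∈ IsManifold.maximalAtlas (𝓡 (d + 1)) ∞ M,
      IsGradAlong (g.lower u e) e.target (scal (g.comp e))
        (fun y => (D R : M → ℝ) (e.symm y)) :=
    fun e he => (hD R e he).congr e.open_target fun x hx => (hR e he x hx).1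
  refine ⟨fun κ Λ₀ α β γ _ => ?_, isPerfectFluid_of_timeScalars A B hric,
    isPerfectFluid_of_timeScalars (D R * φ) (D (D R) + D R * φ) fun e he x hx k l =>
      (hT e he).hess_eq (hscal e he) (hD _ e he) hx k l,
    isPerfectFluid_of_timeScalars
      (-D (D A) + (d : ℝ) • (φ * D A) + (2 : ℝ) • (B * φ ^ 2))
      (-D (D B) + (d : ℝ) • (φ * D B) + (2 * ((d : ℝ) + 1)) • (B * φ ^ 2)) fun e he x hx k l => ?_,
    isPerfectFluid_of_timeScalars (A ^ 2) ((2 : ℝ) • (A * B) - B ^ 2) fun e he x hx k l => ?_,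
    isPerfectFluid_of_timeScalars (A ^ 2 - B * (P - Q)) (A * B - B * (P - Q))
      fun e he x hx k l =>
        riemRic_eq (hT e he).metric hx ((hT e he).unit x hx) (hric e he x hx) (hriem e he x hx) k l,
    isPerfectFluid_of_timeScalars ((2 : ℝ) • (P - Q) ^ 2 + (2 * ((d : ℝ) - 1)) • P ^ 2)
      ((2 : ℝ) • (P - Q) ^ 2 + (2 * ((d : ℝ) - 1)) • P ^ 2 - (2 * (d : ℝ)) • (P - Q) ^ 2)
      fun e he x hx k l => ?_⟩
  · obtain ⟨E, hE⟩ : ∃ E : timeScalars g u, ∀ e ∈ IsManifold.maximalAtlas (𝓡 (d + 1)) ∞ M,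
        ∀ x ∈ e.target, ∀ i j,
        ric (g.comp e) x i j - 1 / 2 * scal (g.comp e) x * g.comp e x i j
          = (E : M → ℝ) (e.symm x) * g.comp e x i j
            + (B : M → ℝ) (e.symm x) * (g.lower u e x i * g.lower u e x j) := by
      -- The Einstein tensor has the same `u ⊗ u` coefficient `B` as the Ricci tensor; only the
      -- coefficient of `g` is shifted.
      refine ⟨A - (1 / 2 : ℝ) • R, fun e he x hx i j => ?_⟩
      rw [hric e he x hx, (hR e he x hx).1]
      push_cast
      simp only [Pi.sub_apply, Pi.smul_apply, smul_eq_mul]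
      ring
    -- `S` is the coefficient of `g` in `R_{kcde} R_l{}^{cde}`, `N` is `R_{ab} Rᵃᵇ`, and `GB` is the
    -- Gauss-Bonnet scalar, in which `d S + 2 d (P - Q)²` is the square of the Riemann tensor.
    let S : timeScalars g u := (2 : ℝ) • (P - Q) ^ 2 + (2 * ((d : ℝ) - 1)) • P ^ 2
    let N : timeScalars g u := ((d : ℝ) + 1) • A ^ 2 - ((2 : ℝ) • (A * B) - B ^ 2)
    let GB : timeScalars g u := (d : ℝ) • S + (2 * (d : ℝ)) • (P - Q) ^ 2 - (4 : ℝ) • N + R ^ 2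
    refine isPerfectFluid_of_timeScalars
      ((1 / κ) • (A - (1 / 2 : ℝ) • R + Λ₀ • 1) + (2 * α) • (R * (A - (1 / 4 : ℝ) • R))
        + (2 * α + β) • ((d : ℝ) • (D R * φ) - D (D R) - D R * φ)
        + (2 * γ) • (R * A - (2 : ℝ) • (A ^ 2 - B * (P - Q)) + S - (2 : ℝ) • A ^ 2
          - (1 / 4 : ℝ) • GB)
        + β • (-D (D E) + (d : ℝ) • (φ * D E) + (2 : ℝ) • (B * φ ^ 2))
        + (2 * β) • (A ^ 2 - B * (P - Q) - (1 / 4 : ℝ) • N))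
      ((1 / κ) • B + (2 * α) • (R * B) - (2 * α + β) • (D (D R) + D R * φ)
        + (2 * γ) • (R * B - (2 : ℝ) • (A * B - B * (P - Q)) + (S - (2 * (d : ℝ)) • (P - Q) ^ 2)
          - (2 : ℝ) • ((2 : ℝ) • (A * B) - B ^ 2))
        + β • (-D (D B) + (d : ℝ) • (φ * D B) + (2 * ((d : ℝ) + 1)) • (B * φ ^ 2))
        + (2 * β) • (A * B - B * (P - Q))) fun e he x hx k l => ?_
    have hm := (hT e he).metric
    have hu := (hT e he).unit x hx
    have hr := hric e he x hx
    unfold stressEnergy gaussBonnet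
    rw [(hT e he).box2_perfectFluid (hD φ e he) (hD E e he) (hD _ e he) (hD B e he) (hD _ e he)
        (hE e he) hx, (hT e he).hess_eq (hscal e he) (hD _ e he) hx,
      (hT e he).box0_eq (hscal e he) (hD _ e he) hx,
      riemRic_eq hm hx hu hr (hriem e he x hx), riemRiem_eq hm hx hu (hriem e he x hx),
      riemSq_eq hm hx hu (hriem e he x hx), ricRic_eq hm hx hu hr, ricSq_eq hm hx hu hr, hr,
      (hR e he x hx).1]
    simp only [S, N, GB]
    push_cast
    simp only [Pi.add_apply, Pi.sub_apply, Pi.mul_apply, Pi.neg_apply, Pi.pow_apply, Pi.smul_apply,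
      Pi.one_apply, smul_eq_mul]
    ring
  · rw [(hT e he).box2_perfectFluid (hD φ e he) (hD A e he) (hD _ e he) (hD B e he) (hD _ e he)
      (hric e he) hx]
    push_cast
    simp only [Pi.add_apply, Pi.mul_apply, Pi.neg_apply, Pi.pow_apply, Pi.smul_apply, smul_eq_mul]
    ring
  · rw [ricRic_eq (hT e he).metric hx ((hT e he).unit x hx) (hric e he x hx)]
    push_cast
    simp only [Pi.sub_apply, Pi.mul_apply, Pi.pow_apply, Pi.smul_apply, smul_eq_mul]
    ring
  · rw [riemRiem_eq (hT e he).metric hx ((hT e he).unit x hx) (hriem e he x hx)]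
    push_cast
    simp only [Pi.add_apply, Pi.sub_apply, Pi.pow_apply, Pi.smul_apply, smul_eq_mul]
    ring
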